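/- Let $N\ge 1$ and $P>0$. The equation $(1+NP\varphi)^{N-1}=\bigl(1+P\varphi(N-\varphi)\bigr)^{N}$ has a unique solution $\varphi=\varphi(P)$ in $[1,N]$. Put $R^*(P)=\frac12\log_2\bigl(1+NP\varphi(P)\bigr)$; the sum rates $R(P)<R^*(P)$ are those achieved by Kramer's feedback code for the $N$-sender real additive white Gaussian noise multiple access channel with unit noise variance and equal power $P$ per sender. For $\beta>1$ let $A=\mathrm{diag}(\beta\omega_1,\dots,\beta\omega_N)$ with $\omega_j=e^{2\pi\sqrt{-1}(j-1)/N}$, let $B=(1,\dots,1)^T$, and let $'$ denote the conjugate transpose. Consider the complex system $S_i=AS_{i-1}+BY_{i-1}$ $(i\ge1)$, $S_0=(M_1,\dots,M_N)$, $Y_0=0$, $Y_i=\sum_jX_{ji}+Z_i$ for $i\ge 1$, with $X_{ji}=\pi_{ji}(S_i(j))$, $\pi_{ji}$ measurable. The $Z_i$ are i.i.d. $\mathcal{CN}(0,1)$, and the messages $M_j$ are independent of each other and of the noise, and uniform on $(0,1)\times(0,1)\subset\mathbb C$. The decoder forms $\hat S_0=0$, $\hat S_i=A\hat S_{i-1}+BY_{i-1}$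 and $\hat M_n=-A^{-n}\hat S_n$. The controller $\pi$ is called stabilizing if $\limsup_n E|S_n(j)|^2<\infty$ for all $j$. The optimal LTI code is the one with the linear controller $X_{ji}=-c_jS_i(j)$, where $(c_1,\dots,c_N)=(B'GB+1)^{-1}B'GA$ and $G$ is the positive definite solution of $G=A'GA-A'GB(B'GB+1)^{-1}B'GA$. A code achieves the sum rate $R$ under power constraint $P$ (rates in bits per real dimension, one complex channel use counting as two real ones) if there are $r_j\ge0$ with $\sum_jr_j=R$ such that, for each $n$ and each $j$, there are $\lceil2^{2nr_j}\rceil$ points of $(0,1)\times(0,1)$ representing the messages of sender $j$, and a measurable decision rule applied to $\hat M_n(j)$, for which the following holds with independent messages, uniform on the message sets, sent as initial states: the probability that some message is decoded incorrectly tends to $0$ as $n\to\infty$, and $\sum_{i=1}^nE|X_{ji}|^2\le nP$ for every $j$ and all sufficiently large $n$. Then: (a) For every $R$ with $0\le R<R^*(P)$ there is a $\beta>1$ such that the positive definite solution $G$ exists and is unique and the optimal LTI code has the following properties. Its controller is stabilizing and minimizes the asymptotic power $\lim_n\frac1n\sum_{i=1}^nE|\sum_jX_{ji}|^2$: the limsup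 of these averages is at most the liminf of the corresponding averages for any stabilizing controller of the form $X_{ji}=\pi_{ji}(S_i(j))$. Moreover, for every $j$, $-\frac1{2n}\log_2E|M_j-\hat M_n(j)|^2\to\log_2\beta$, and $N\log_2\beta>R$. The asymptotic powers $\lim_nE|X_{jn}|^2$ exist and lie in $(0,P)$ for every $j$. The code achieves the sum rate $R$ under power constraint $P$. (b) There is a $\beta>1$ for which $G$ again exists and is unique, the optimal LTI code is optimal in the same sense, the mean square error exponents are again $\log_2\beta$, $N\log_2\beta=R^*(P)$, and $\lim_nE|X_{jn}|^2=P$ for every $j$. This code achieves every sum rate $R$ with $0\le R<R^*(P)$ under power constraint $P'$ for every $P'>P$. -/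

import Mathlib

open MeasureTheory ProbabilityTheory Filter Topology
open scoped ENNReal Matrix ComplexOrder

noncomputable section

namespace AWGNMAC

/-! ### The equation defining `φ(P)` and the sum rate -/

/-- `φ ∈ [1, N]` solves `(1 + N P φ)^(N-1) = (1 + P φ (N - φ))^N`. -/
def IsKramerPhi (N : ℕ) (P φ : ℝ) : Prop :=
  φ ∈ Set.Icc (1 : ℝ) N ∧
    (1 + N * P * φ) ^ (N - 1) = (1 + P * φ * (N - φ)) ^ N

/-- `(1/2) log₂ (1 + N P φ)`: every sum rate below this number (with `φ = φ(P)`) is achieved by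
Kramer's code under equal power `P`; in bits per use of the real channel. -/
def kramerSumRate (N : ℕ) (P φ : ℝ) : ℝ :=
  1 / 2 * Real.logb 2 (1 + N * P * φ)

/-! ### Message and noise laws -/

/-- The circularly symmetric complex Gaussian law `CN(0, 1)`. -/
def complexGaussian : Measure ℂ :=
  ((gaussianReal 0 (1 / 2)).prod (gaussianReal 0 (1 / 2))).map Complex.measurableEquivRealProd.symm

instance : IsProbabilityMeasure complexGaussian :=
  Measure.isProbabilityMeasure_map Complex.measurableEquivRealProd.symm.measurable.aemeasurable

/-- The law of the i.i.d. `CN(0, 1)` noise sequence. The noise at time `i` is coordinate `i`;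
coordinate `0` is never used. -/
def noiseLaw : Measure (ℕ → ℂ) :=
  Measure.infinitePi fun _ => complexGaussian

instance : IsProbabilityMeasure noiseLaw := by
  unfold noiseLaw; infer_instance

/-- The open unit square `(0,1) × (0,1)` in the complex plane. -/
def unitSquare : Set ℂ := Set.Ioo 0 1 ×ℂ Set.Ioo 0 1

/-- The law of `N` independent messages, each uniform on the open unit square. -/
def uniformMessageLaw (N : ℕ) : Measure (Fin N → ℂ) :=
  Measure.pi fun _ => ProbabilityTheory.cond (volume : Measure ℂ) unitSquare

/-! ### The linear system, controllers and the closed loop -/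

/-- `A = diag(β₁ω₁, …, β_Nω_N)`. -/
def systemA {N : ℕ} (β : Fin N → ℝ) (ω : Fin N → ℂ) : Matrix (Fin N) (Fin N) ℂ :=
  Matrix.diagonal fun j => (β j : ℂ) * ω j

/-- `B = (1, …, 1)ᵀ`. -/
def systemB (N : ℕ) : Matrix (Fin N) (Fin 1) ℂ := fun _ _ => 1

/-- The symmetric system: `β_j = β` and `ω_j = exp(2πi(j-1)/N)`, `j = 1, …, N`. -/
def symmetricA (N : ℕ) (β : ℝ) : Matrix (Fin N) (Fin N) ℂ :=
  systemA (fun _ => β) fun j => Complex.exp (2 * Real.pi * Complex.I * (j : ℕ) / N)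

/-- A separated controller: sender `j` transmits at time `i` the symbol `π j i (S_i(j))`. -/
abbrev Controller (N : ℕ) : Type := Fin N → ℕ → ℂ → ℂ

/-- The channel output when the state is `s` at time `i` and the noise sample is `z`
(with the convention `Y₀ = 0`). -/
def outputOf {N : ℕ} (π : Controller N) (i : ℕ) (s : Fin N → ℂ) (z : ℂ) : ℂ :=
  if i = 0 then 0 else ∑ j, π j i (s j) + z

/-- The closed-loop state: `S₀ = s₀` and `S_{i+1} = A S_i + B Y_i`. -/
def state {N : ℕ} (A : Matrix (Fin N) (Fin N) ℂ) (π : Controller N)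
    (s₀ : Fin N → ℂ) (z : ℕ → ℂ) : ℕ → Fin N → ℂ
  | 0 => s₀
  | i + 1 =>
      A *ᵥ state A π s₀ z i + systemB N *ᵥ fun _ => outputOf π i (state A π s₀ z i) (z i)

/-- The channel output `Y_i` of the closed loop. -/
def output {N : ℕ} (A : Matrix (Fin N) (Fin N) ℂ) (π : Controller N)
    (s₀ : Fin N → ℂ) (z : ℕ → ℂ) (i : ℕ) : ℂ :=
  outputOf π i (state A π s₀ z i) (z i)

/-- The symbol `X_{ji}` transmitted by sender `j` at time `i`. -/
def userInput {N : ℕ} (A : Matrix (Fin N) (Fin N) ℂ) (π : Controller N)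
    (s₀ : Fin N → ℂ) (z : ℕ → ℂ) (j : Fin N) (i : ℕ) : ℂ :=
  π j i (state A π s₀ z i j)

/-- The decoder recursion driven by the outputs: `Ŝ₀ = 0`, `Ŝ_{i+1} = A Ŝ_i + B Y_i`. -/
def decoderState {N : ℕ} (A : Matrix (Fin N) (Fin N) ℂ) (y : ℕ → ℂ) : ℕ → Fin N → ℂ
  | 0 => 0
  | i + 1 => A *ᵥ decoderState A y i + systemB N *ᵥ fun _ => y i

/-- The message estimate `M̂_n = -A^{-n} Ŝ_n`, a function of the channel outputs. -/
def estimate {N : ℕ} (A : Matrix (Fin N) (Fin N) ℂ) (n : ℕ) (y : ℕ → ℂ) : Fin N → ℂ :=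
  -((A⁻¹ ^ n) *ᵥ decoderState A y n)

/-! ### Powers, mean square errors, stability and optimality

Below `ρ` is the law of the initial state (the message vector), independent of the noise.
Second moments are computed in `[0, ∞]`. -/

/-- `E |X_{ji}|²`. -/
def userPower {N : ℕ} (A : Matrix (Fin N) (Fin N) ℂ) (π : Controller N)
    (ρ : Measure (Fin N → ℂ)) (j : Fin N) (i : ℕ) : ℝ≥0∞ :=
  ∫⁻ p, ‖userInput A π p.1 p.2 j i‖ₑ ^ 2 ∂(ρ.prod noiseLaw)

/-- `(1/n) ∑_{i=1}^n E |X_i|²` for the combined signal `X_i = ∑_j X_{ji}`, with the messages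
uniform on the unit square. -/
def averageControlPower {N : ℕ} (A : Matrix (Fin N) (Fin N) ℂ) (π : Controller N)
    (n : ℕ) : ℝ≥0∞ :=
  (∑ i ∈ Finset.Icc 1 n,
    ∫⁻ p, ‖∑ j, userInput A π p.1 p.2 j i‖ₑ ^ 2 ∂((uniformMessageLaw N).prod noiseLaw)) / n

/-- The mean square error `D_j^{(n)} = E |M_j - M̂_j|²` for uniform messages. -/
def mse {N : ℕ} (A : Matrix (Fin N) (Fin N) ℂ) (π : Controller N) (j : Fin N) (n : ℕ) : ℝ≥0∞ :=
  ∫⁻ p, ‖p.1 j - estimate A n (output A π p.1 p.2) j‖ₑ ^ 2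
    ∂((uniformMessageLaw N).prod noiseLaw)

/-- The exponent `-(1/(2n)) log₂ D_j^{(n)}` of the mean square error. -/
def mseExponent {N : ℕ} (A : Matrix (Fin N) (Fin N) ℂ) (π : Controller N) (j : Fin N)
    (n : ℕ) : ℝ :=
  -(1 / (2 * n)) * Real.logb 2 (mse A π j n).toReal

/-- The controller stabilizes the system: `limsup E |S_n(j)|² < ∞` for every mode `j`. -/
def Stabilizes {N : ℕ} (A : Matrix (Fin N) (Fin N) ℂ) (π : Controller N) : Prop :=
  ∀ j, limsup (fun n => ∫⁻ p, ‖state A π p.1 p.2 n j‖ₑ ^ 2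
    ∂((uniformMessageLaw N).prod noiseLaw)) atTop < ∞

/-- The controller is stabilizing and its asymptotic power is minimal among all (possibly
nonlinear and time-varying) separated stabilizing controllers. -/
def IsOptimalController {N : ℕ} (A : Matrix (Fin N) (Fin N) ℂ) (π : Controller N) : Prop :=
  Stabilizes A π ∧
    ∀ π' : Controller N, (∀ j i, Measurable (π' j i)) → Stabilizes A π' →
      limsup (averageControlPower A π) atTop ≤ liminf (averageControlPower A π') atTop

/-! ### The Riccati equation and the resulting linear controller -/

/-- `G` solves `G = A'GA - A'GB (B'GB + 1)⁻¹ B'GA`, where `'` is the conjugate transpose. -/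
def IsDARESolution {N : ℕ} (A : Matrix (Fin N) (Fin N) ℂ) (G : Matrix (Fin N) (Fin N) ℂ) : Prop :=
  G = Aᴴ * G * A -
    Aᴴ * G * systemB N * ((systemB N)ᴴ * G * systemB N + 1)⁻¹ * ((systemB N)ᴴ * G * A)

/-- The gain `C = (B'GB + 1)⁻¹ B'GA`. -/
def gain {N : ℕ} (A : Matrix (Fin N) (Fin N) ℂ) (G : Matrix (Fin N) (Fin N) ℂ) :
    Matrix (Fin 1) (Fin N) ℂ :=
  ((systemB N)ᴴ * G * systemB N + 1)⁻¹ * ((systemB N)ᴴ * G * A)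

/-- `G` is a positive definite solution of the Riccati equation. -/
def IsPosDefDARESolution {N : ℕ} (A : Matrix (Fin N) (Fin N) ℂ)
    (G : Matrix (Fin N) (Fin N) ℂ) : Prop :=
  G.PosDef ∧ IsDARESolution A G

/-- The stationary linear controller `X_i = -C S_i`: sender `j` transmits `-c_j S_i(j)`. -/
def linearController {N : ℕ} (C : Matrix (Fin 1) (Fin N) ℂ) : Controller N :=
  fun j _ s => -(C 0 j * s)

/-- The stationary linear controller with the gain given by the Riccati solution `G`. -/
def dareController {N : ℕ} (A : Matrix (Fin N) (Fin N) ℂ) (G : Matrix (Fin N) (Fin N) ℂ) :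
    Controller N :=
  linearController (gain A G)

/-! ### Achievable rates

One use of the complex channel counts as two uses of the real channel. Rates are in bits per use
of the real channel, so that a block of `n` complex uses carries `2 n r` bits. -/

/-- The number `⌈2^{2nr}⌉` of messages of rate `r` for a block of `n` complex channel uses. -/
def messageCount (n : ℕ) (r : ℝ) : ℕ := ⌈(2 : ℝ) ^ (2 * n * r)⌉₊

/-- The uniform law on the message tuples `(m_1, …, m_N)`, `m_j ∈ {1, …, K_j}`. -/
def discreteMessageLaw {N : ℕ} (K : Fin N → ℕ) : Measure (∀ j, Fin (K j)) :=
  Measure.pi fun _ => uniformOn Set.univ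

/-- The initial state assigned to a message tuple by the message points `θ_j`. -/
def messagePoint {N : ℕ} {K : Fin N → ℕ} (θ : ∀ j, Fin (K j) → ℂ) (m : ∀ j, Fin (K j)) :
    Fin N → ℂ := fun j => θ j (m j)

/-- The probability that some message is decoded incorrectly when message `m_j` is sent as the
initial state `θ_j(m_j)`, the block length is `n`, and message `j` is decided to be `dec_j` of the
estimate of the `j`-th initial state. -/
def errorProbability {N : ℕ} (A : Matrix (Fin N) (Fin N) ℂ) (π : Controller N) (n : ℕ)
    {K : Fin N → ℕ} (θ : ∀ j, Fin (K j) → ℂ) (dec : ∀ j, ℂ → Fin (K j)) : ℝ≥0∞ :=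
  ((discreteMessageLaw K).prod noiseLaw)
    {p | (fun j => dec j (estimate A n (output A π (messagePoint θ p.1) p.2) j)) ≠ p.1}

/-- The LTI code given by the system `A` and the controller `π` achieves the rates `r_j` with block
power constraint `P` for every sender: for suitable message points in the unit square and suitable
measurable decisions, the error probability tends to `0`, and the power constraint holds for all
sufficiently long blocks. -/
def AchievesRates {N : ℕ} (A : Matrix (Fin N) (Fin N) ℂ) (π : Controller N)
    (r : Fin N → ℝ) (P : ℝ) : Prop :=
  ∃ (θ : ∀ (n : ℕ) (j : Fin N), Fin (messageCount n (r j)) → ℂ)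
    (dec : ∀ (n : ℕ) (j : Fin N), ℂ → Fin (messageCount n (r j))),
    (∀ n j m, θ n j m ∈ unitSquare) ∧ (∀ n j, Measurable (dec n j)) ∧
    Tendsto (fun n => errorProbability A π n (θ n) (dec n)) atTop (𝓝 0) ∧
    ∀ j, ∀ᶠ n : ℕ in atTop,
      ∑ i ∈ Finset.Icc 1 n,
        userPower A π
          ((discreteMessageLaw fun j => messageCount n (r j)).map (messagePoint (θ n))) j i
        ≤ ENNReal.ofReal (n * P)

/-- The LTI code achieves the sum rate `R` with block power constraint `P` for every sender. -/
def AchievesSumRate {N : ℕ} (A : Matrix (Fin N) (Fin N) ℂ) (π : Controller N) (R P : ℝ) : Prop :=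
  ∃ r : Fin N → ℝ, (∀ j, 0 ≤ r j) ∧ ∑ j, r j = R ∧ AchievesRates A π r P

end AWGNMAC

end

open AWGNMAC

namespace AWGNMAC

/-! ### White complex Gaussian noise: second moments and independence of one sample. -/

section Noise

/-! Everything diagonalizes in the discrete Fourier transform over the `N`-th roots of unity. In the
coordinates `mode β r s`, proportional to `∑ ω_k^r s_k`, one step of the system shifts the index
`r`, and the scalar input enters only where `N ∣ r`. Weighting the modes `1, …, N` equally gives an
explicit Riccati solution `riccatiSolution` with `B'GB + 1 = β^(2N)` and gains all of the same
modulus. It is the only positive definite one, because the inverse of any such solution satisfies a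
Lyapunov equation that determines every entry (`lyapunov_of_riccati`).

Optimality is dynamic programming with value function `s'Gs`. By `valueFunction_next` a step removes
one mode and adds another; completing the square shows that each step costs at least `β^(2N) - 1` on
average, up to a telescoping term, with equality for the Riccati controller. Nothing here uses
linearity of the competing controller.

The optimal closed loop has an explicit impulse response (`closedLoop_response`): it grows by `β`
per step and is damped by `β^(-2N)` once every `N` steps. Hence every `E|S_n(j)|²` converges to
`stationaryMoment`, whatever the law of the bounded initial state, and the sender powers converge to
`senderPower N (β²)`. The estimation error is `A^{-n} S_n`, so the mean square exponent is `log₂ β`;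
separated message points, Markov's inequality and a Cesàro mean of the vanishing transient turn this
into achievable rates.

The link with Kramer's code is the substitution `b^N = 1 + N P φ`, `b = β²`: it turns the equation
for `φ` into `senderPower N b = P`. Since `senderPower` is strictly increasing, `φ` is unique, and
any smaller `β` leaves power to spare, which gives (a); the critical `β` gives (b). -/

lemma lintegral_add_sq_gaussianReal (c : ℝ) (v : NNReal) :
    ∫⁻ x, ENNReal.ofReal ((c + x) ^ 2) ∂(gaussianReal 0 v) = ENNReal.ofReal (c ^ 2 + v) := by
  have h2 : MemLp (id : ℝ → ℝ) 2 (gaussianReal 0 v) := memLp_id_gaussianReal 2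
  have h1 : Integrable (fun x : ℝ => x) (gaussianReal 0 v) := h2.integrable (by norm_num)
  have hsq : Integrable (fun x : ℝ => x ^ 2) (gaussianReal 0 v) := h2.integrable_sq
  have hvar : ∫ x, x ^ 2 ∂(gaussianReal 0 v) = v := by
    have h := variance_id_gaussianReal (μ := 0) (v := v)
    rw [variance_of_integral_eq_zero aemeasurable_id (by simp)] at h
    simpa using h
  have hexp : ∀ x : ℝ, (c + x) ^ 2 = c ^ 2 + 2 * c * x + x ^ 2 := fun x => by ring
  have hint : Integrable (fun x : ℝ => c ^ 2 + 2 * c * x + x ^ 2) (gaussianReal 0 v) :=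
    ((integrable_const _).add (h1.const_mul _)).add hsq
  rw [← ofReal_integral_eq_lintegral_ofReal (by simpa only [hexp] using hint)
    (Eventually.of_forall fun x => sq_nonneg _)]
  simp only [hexp]
  rw [integral_add (f := fun x => c ^ 2 + 2 * c * x) ((integrable_const _).add (h1.const_mul _)) hsq,
    integral_add (integrable_const _) (h1.const_mul _), integral_const_mul, hvar,
    integral_id_gaussianReal]
  simp

lemma enorm_sq_eq_ofReal (z : ℂ) : ‖z‖ₑ ^ 2 = ENNReal.ofReal (‖z‖ ^ 2) := by
  rw [← ofReal_norm, ENNReal.ofReal_pow (norm_nonneg _)]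

lemma enorm_sq_eq_re_add_im (z : ℂ) :
    ‖z‖ₑ ^ 2 = ENNReal.ofReal (z.re ^ 2) + ENNReal.ofReal (z.im ^ 2) := by
  rw [enorm_sq_eq_ofReal, ← ENNReal.ofReal_add (sq_nonneg _) (sq_nonneg _), Complex.sq_norm,
    Complex.normSq_apply, sq, sq]

/-- Adding `CN(0, 1)` noise to a constant adds `1` to the second moment. -/
lemma lintegral_add_complexGaussian (a : ℂ) :
    ∫⁻ w, ‖a + w‖ₑ ^ 2 ∂complexGaussian = ‖a‖ₑ ^ 2 + 1 := by
  have hm : ∀ c : ℝ, Measurable fun x : ℝ => ENNReal.ofReal ((c + x) ^ 2) := fun c => by fun_prop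
  rw [complexGaussian, lintegral_map (by fun_prop)
    Complex.measurableEquivRealProd.symm.measurable]
  have h : ∀ p : ℝ × ℝ, ‖a + Complex.measurableEquivRealProd.symm p‖ₑ ^ 2 =
      ENNReal.ofReal ((a.re + p.1) ^ 2) + ENNReal.ofReal ((a.im + p.2) ^ 2) := fun p => by
    rw [enorm_sq_eq_re_add_im]
    simp [Complex.measurableEquivRealProd_symm_apply]
  simp only [h]
  rw [lintegral_prod _ (by fun_prop)]
  simp only [lintegral_add_left' aemeasurable_const, lintegral_const, measure_univ, mul_one,
    lintegral_add_sq_gaussianReal]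
  rw [lintegral_add_right' _ aemeasurable_const, lintegral_add_sq_gaussianReal, lintegral_const,
    measure_univ, mul_one, enorm_sq_eq_re_add_im, ENNReal.ofReal_add (sq_nonneg _) (by positivity),
    ENNReal.ofReal_add (sq_nonneg _) (by positivity)]
  have : ENNReal.ofReal ((1 / 2 : NNReal) : ℝ) + ENNReal.ofReal ((1 / 2 : NNReal) : ℝ) = 1 := by
    rw [← ENNReal.ofReal_add (by positivity) (by positivity)]
    norm_num
  rw [← this]
  abel

/-- Resampling one coordinate does not change the noise law. -/
lemma measurePreserving_update_noise (i : ℕ) :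
    MeasurePreserving (fun p : (ℕ → ℂ) × ℂ => Function.update p.1 i p.2)
      (noiseLaw.prod complexGaussian) noiseLaw := by
  have hm : Measurable fun p : (ℕ → ℂ) × ℂ => Function.update p.1 i p.2 := by
    refine measurable_pi_lambda _ fun k => ?_
    by_cases hk : k = i
    · subst hk; simpa using measurable_snd
    · simp only [Function.update_of_ne hk]
      fun_prop
  -- It suffices to compare measures of finite cylinders: one constraining coordinate `i` splits off
  -- a factor in the fresh sample, any other does not see it.
  refine ⟨hm, Measure.eq_infinitePi _ fun s t ht => ?_⟩
  have hpi : MeasurableSet ((s : Set ℕ).pi t) :=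
    MeasurableSet.pi s.countable_toSet fun k _ => ht k
  rw [Measure.map_apply hm hpi]
  by_cases hi : i ∈ s
  · have : (fun p : (ℕ → ℂ) × ℂ => Function.update p.1 i p.2) ⁻¹' ((s : Set ℕ).pi t) =
        (((s.erase i : Finset ℕ) : Set ℕ).pi t) ×ˢ t i := by
      ext p
      simp only [Set.mem_preimage, Set.mem_pi, Set.mem_prod, Finset.mem_coe, Finset.mem_erase]
      constructor
      · intro h
        refine ⟨fun k hk => ?_, by simpa using h i hi⟩
        simpa [Function.update_of_ne hk.1] using h k hk.2
      · rintro ⟨h1, h2⟩ k hk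
        by_cases hki : k = i
        · subst hki; simpa using h2
        · simpa [Function.update_of_ne hki] using h1 k ⟨hki, hk⟩
    rw [this, Measure.prod_prod, noiseLaw, Measure.infinitePi_pi _ (fun k _ => ht k),
      Finset.prod_erase_mul s (fun k => complexGaussian (t k)) hi]
  · have : (fun p : (ℕ → ℂ) × ℂ => Function.update p.1 i p.2) ⁻¹' ((s : Set ℕ).pi t) =
        ((s : Set ℕ).pi t) ×ˢ Set.univ := by
      ext p
      simp only [Set.mem_preimage, Set.mem_pi, Set.mem_prod, Finset.mem_coe, Set.mem_univ, and_true]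
      refine forall₂_congr fun k hk => ?_
      rw [Function.update_of_ne (fun h : k = i => hi (h ▸ hk))]
    rw [this, Measure.prod_prod, measure_univ, mul_one, noiseLaw,
      Measure.infinitePi_pi _ (fun k _ => ht k)]

/-- If `f` does not depend on the `i`-th noise sample, then that sample may be integrated out
first. -/
lemma lintegral_noise_of_update {f : (ℕ → ℂ) → ℂ} (hf : Measurable f) (i : ℕ)
    (hfi : ∀ z w, f (Function.update z i w) = f z) {F : ℂ × ℂ → ℝ≥0∞} (hF : Measurable F) :
    ∫⁻ z, F (f z, z i) ∂noiseLaw = ∫⁻ z, ∫⁻ w, F (f z, w) ∂complexGaussian ∂noiseLaw := by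
  have hg : Measurable fun z : ℕ → ℂ => F (f z, z i) :=
    hF.comp (hf.prodMk (measurable_pi_apply i))
  -- After resampling coordinate `i`, `f` is unchanged and the sample is an independent variable of
  -- the product.
  rw [← (measurePreserving_update_noise i).lintegral_comp hg]
  simp only [hfi, Function.update_self]
  exact lintegral_prod _ (hF.comp ((hf.comp measurable_fst).prodMk measurable_snd)).aemeasurable

lemma lintegral_add_noise {f : (ℕ → ℂ) → ℂ} (hf : Measurable f) (i : ℕ)
    (hfi : ∀ z w, f (Function.update z i w) = f z) :
    ∫⁻ z, ‖f z + z i‖ₑ ^ 2 ∂noiseLaw = ∫⁻ z, ‖f z‖ₑ ^ 2 ∂noiseLaw + 1 := by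
  rw [lintegral_noise_of_update (F := fun p => ‖p.1 + p.2‖ₑ ^ 2) hf i hfi (by fun_prop)]
  simp only [lintegral_add_complexGaussian]
  rw [lintegral_add_right' _ aemeasurable_const]
  simp

lemma lintegral_add_mul_noise {f : (ℕ → ℂ) → ℂ} (hf : Measurable f) (i : ℕ)
    (hfi : ∀ z w, f (Function.update z i w) = f z) (a : ℂ) :
    ∫⁻ z, ‖f z + z i * a‖ₑ ^ 2 ∂noiseLaw = ∫⁻ z, ‖f z‖ₑ ^ 2 ∂noiseLaw + ‖a‖ₑ ^ 2 := by
  by_cases ha : a = 0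
  · simp [ha]
  have h : ∀ z : ℕ → ℂ, ‖f z + z i * a‖ₑ ^ 2 = ‖a‖ₑ ^ 2 * ‖f z / a + z i‖ₑ ^ 2 := fun z => by
    rw [← mul_pow, ← enorm_mul, mul_add, mul_div_cancel₀ _ ha, mul_comm a]
  have h' : ∀ z : ℕ → ℂ, ‖f z‖ₑ ^ 2 = ‖a‖ₑ ^ 2 * ‖f z / a‖ₑ ^ 2 := fun z => by
    rw [← mul_pow, ← enorm_mul, mul_div_cancel₀ _ ha]
  simp only [h, h']
  rw [lintegral_const_mul' _ _ (by simp), lintegral_const_mul' _ _ (by simp),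
    lintegral_add_noise (hf.div_const a) i (fun z w => by rw [hfi]), mul_add, mul_one]

/-- The second moment of a constant plus a linear combination of noise samples. -/
lemma lintegral_const_add_sum_noise (L : ℂ) (a : ℕ → ℂ) (m : ℕ) :
    ∫⁻ z, ‖L + ∑ k ∈ Finset.range m, z (k + 1) * a k‖ₑ ^ 2 ∂noiseLaw =
      ‖L‖ₑ ^ 2 + ∑ k ∈ Finset.range m, ‖a k‖ₑ ^ 2 := by
  induction m with
  | zero => simp
  | succ m ih =>
    simp only [Finset.sum_range_succ, ← add_assoc]
    rw [lintegral_add_mul_noise (by fun_prop), ih]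
    intro z w
    congr 1
    refine Finset.sum_congr rfl fun k hk => ?_
    rw [Function.update_of_ne (by have := Finset.mem_range.1 hk; omega)]

end Noise

/-! ### Character sums and Fourier inversion over the roots of unity. -/

section Roots

/-- The `N`-th root of unity `exp(2πi j/N)`. -/
noncomputable def root (N : ℕ) (j : Fin N) : ℂ :=
  Complex.exp (2 * Real.pi * Complex.I * (j : ℕ) / N)

lemma root_eq_pow (N : ℕ) (j : Fin N) :
    root N j = Complex.exp (2 * Real.pi * Complex.I / N) ^ (j : ℕ) := by
  rw [root, ← Complex.exp_nat_mul]
  congr 1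
  ring

variable {N : ℕ}

lemma norm_root (j : Fin N) : ‖root N j‖ = 1 := by
  have : 2 * (Real.pi : ℂ) * Complex.I * (j : ℕ) / N =
      ((2 * Real.pi * (j : ℕ) / N : ℝ) : ℂ) * Complex.I := by
    push_cast; ring
  rw [root, this, Complex.norm_exp_ofReal_mul_I]

lemma root_ne_zero (j : Fin N) : root N j ≠ 0 := Complex.exp_ne_zero _

lemma root_mul_conj (j : Fin N) : root N j * star (root N j) = 1 := by
  rw [Complex.star_def, Complex.mul_conj, Complex.normSq_eq_norm_sq, norm_root]
  simp

lemma root_pow_card (j : Fin N) : root N j ^ N = 1 := by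
  have hN : N ≠ 0 := (Fin.pos j).ne'
  rw [root_eq_pow, ← pow_mul, mul_comm (j : ℕ), pow_mul, (Complex.isPrimitiveRoot_exp N hN).pow_eq_one,
    one_pow]

lemma root_pow_eq_one_of_dvd (j : Fin N) {m : ℕ} (h : N ∣ m) : root N j ^ m = 1 := by
  obtain ⟨k, rfl⟩ := h
  rw [pow_mul, root_pow_card, one_pow]

lemma sum_root_pow (m : ℕ) : ∑ j, root N j ^ m = if N ∣ m then (N : ℂ) else 0 := by
  rcases Nat.eq_zero_or_pos N with rfl | hN
  · simp
  have hζ := Complex.isPrimitiveRoot_exp N hN.ne'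
  split_ifs with h
  · simp [root_pow_eq_one_of_dvd _ h]
  · have h1 : Complex.exp (2 * Real.pi * Complex.I / N) ^ m ≠ 1 := fun h' =>
      h (hζ.dvd_of_pow_eq_one m h')
    have h2 : ∑ j : Fin N, root N j ^ m =
        ∑ j ∈ Finset.range N, (Complex.exp (2 * Real.pi * Complex.I / N) ^ m) ^ j := by
      rw [← Fin.sum_univ_eq_sum_range]
      refine Finset.sum_congr rfl fun j _ => ?_
      rw [root_eq_pow, ← pow_mul, ← pow_mul, mul_comm (j : ℕ)]
    rw [h2, geom_sum_eq h1, ← pow_mul, mul_comm m, pow_mul, hζ.pow_eq_one, one_pow, sub_self,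
      zero_div]

lemma sum_conj_root_pow (m : ℕ) : ∑ j, star (root N j) ^ m = if N ∣ m then (N : ℂ) else 0 := by
  have h := congrArg star (sum_root_pow (N := N) m)
  rw [star_sum] at h
  simp only [star_pow] at h
  rw [h]
  split_ifs <;> simp

lemma root_mul_conj_ne_one {j k : Fin N} (h : j ≠ k) : root N j * star (root N k) ≠ 1 := by
  intro h'
  have hjk : root N j = root N k := by
    calc root N j = root N j * (root N k * star (root N k)) := by rw [root_mul_conj, mul_one]
      _ = root N j * star (root N k) * root N k := by ring
      _ = root N k := by rw [h', one_mul]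
  rw [root_eq_pow, root_eq_pow] at hjk
  have hζ := Complex.isPrimitiveRoot_exp N (Fin.pos j).ne'
  exact h (Fin.ext (hζ.pow_inj j.2 k.2 hjk))

lemma sum_range_root_mul_conj_pow (j k : Fin N) :
    ∑ t ∈ Finset.range N, (root N j * star (root N k)) ^ t = if j = k then (N : ℂ) else 0 := by
  split_ifs with h
  · subst h; simp only [root_mul_conj, one_pow]; simp
  · have h1 := root_mul_conj_ne_one h
    rw [geom_sum_eq h1, mul_pow, ← star_pow, root_pow_card, root_pow_card]
    simp

/-- Discrete Fourier inversion. -/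
lemma fourier_inversion (s : Fin N → ℂ) (j : Fin N) :
    ∑ t ∈ Finset.range N, root N j ^ t * ((∑ k, star (root N k) ^ t * s k) / N) = s j := by
  have hN : (N : ℂ) ≠ 0 := by exact_mod_cast (Fin.pos j).ne'
  have h : ∀ t, root N j ^ t * ((∑ k, star (root N k) ^ t * s k) / N) =
      ∑ k, (root N j * star (root N k)) ^ t * (s k / N) := fun t => by
    rw [Finset.sum_div, Finset.mul_sum]
    refine Finset.sum_congr rfl fun k _ => ?_
    rw [mul_pow]; ring
  simp only [h]
  rw [Finset.sum_comm]
  simp only [← Finset.sum_mul, sum_range_root_mul_conj_pow, ite_mul, zero_mul]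
  rw [Finset.sum_ite_eq Finset.univ j]
  simp; field_simp

lemma symmetricA_eq (N : ℕ) (β : ℝ) :
    symmetricA N β = Matrix.diagonal fun j => (β : ℂ) * root N j := rfl

end Roots

/-! ### Explicit solution of the Riccati equation and its uniqueness. -/

section Riccati

variable {N : ℕ}

/-- The factor `F` with `G = F'F`. -/
noncomputable def riccatiFactor (N : ℕ) (β : ℝ) : Matrix (Fin N) (Fin N) ℂ :=
  fun r k => ((Real.sqrt (1 - (β ^ (2 * N))⁻¹) * β ^ ((r : ℕ) + 1) / N : ℝ) : ℂ) *
    root N k ^ ((r : ℕ) + 1)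

/-- The explicit positive definite solution of the Riccati equation of the symmetric system. -/
noncomputable def riccatiSolution (N : ℕ) (β : ℝ) : Matrix (Fin N) (Fin N) ℂ :=
  (riccatiFactor N β)ᴴ * riccatiFactor N β

lemma one_sub_inv_pow_pos {β : ℝ} (hβ : 1 < β) (hN : N ≠ 0) : 0 < 1 - (β ^ (2 * N))⁻¹ := by
  have : 1 < β ^ (2 * N) := one_lt_pow₀ hβ (by omega)
  have := inv_lt_one_of_one_lt₀ this
  linarith

/-- The rows are nonzero multiples of the characters of index `1, …, N`, so a vector in the kernel
has vanishing Fourier transform. -/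
lemma riccatiFactor_mulVec_injective {β : ℝ} (hβ : 1 < β) :
    Function.Injective (riccatiFactor N β).mulVec := by
  rw [← Matrix.coe_mulVecLin, ← LinearMap.ker_eq_bot, LinearMap.ker_eq_bot']
  intro s hs
  ext j
  have hN : N ≠ 0 := (Fin.pos j).ne'
  have hNc : (N : ℂ) ≠ 0 := by exact_mod_cast hN
  have hc : ∀ r : Fin N,
      ((Real.sqrt (1 - (β ^ (2 * N))⁻¹) * β ^ ((r : ℕ) + 1) / N : ℝ) : ℂ) ≠ 0 := fun r => by
    have := Real.sqrt_pos.2 (one_sub_inv_pow_pos hβ hN)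
    have hN' : (0 : ℝ) < N := by positivity
    exact_mod_cast (by positivity :
      Real.sqrt (1 - (β ^ (2 * N))⁻¹) * β ^ ((r : ℕ) + 1) / N ≠ 0)
  have hz : ∀ r : Fin N, ∑ k, root N k ^ ((r : ℕ) + 1) * s k = 0 := fun r => by
    have h := congrFun hs r
    simp only [Matrix.coe_mulVecLin, Matrix.mulVec, dotProduct, riccatiFactor, mul_assoc,
      ← Finset.mul_sum, Pi.zero_apply] at h
    exact (mul_eq_zero.1 h).resolve_left (hc r)
  -- One factor `ω_k` moves the exponents `1, …, N` down to `0, …, N-1`; the conjugate matches the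
  -- conjugate characters of the inversion formula.
  have h2 := fourier_inversion (N := N) (fun k => star (root N k * s k)) j
  have h3 : ∀ t ∈ Finset.range N,
      root N j ^ t * ((∑ k, star (root N k) ^ t * star (root N k * s k)) / N) = 0 := by
    intro t ht
    have h4 := congrArg star (hz ⟨t, Finset.mem_range.1 ht⟩)
    rw [star_sum] at h4
    have h5 : ∑ k, star (root N k) ^ t * star (root N k * s k) = 0 := by
      rw [← star_zero ℂ, ← h4]
      refine Finset.sum_congr rfl fun k _ => ?_
      simp only [star_mul', star_pow]
      ring
    rw [h5]; simp
  rw [Finset.sum_eq_zero h3] at h2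
  have h6 : root N j * s j = 0 := by
    rw [← star_eq_zero]; exact h2.symm
  exact (mul_eq_zero.1 h6).resolve_left (root_ne_zero j)

lemma riccatiSolution_posDef {β : ℝ} (hβ : 1 < β) : (riccatiSolution N β).PosDef :=
  Matrix.PosDef.conjTranspose_mul_self _ (riccatiFactor_mulVec_injective hβ)

/-- Each entry is a truncated geometric series, which makes both the column sums and the action of
`A'·A` computable. -/
lemma riccatiSolution_apply {β : ℝ} (hβ : 1 < β) (j k : Fin N) :
    riccatiSolution N β j k = (1 - ((β : ℂ) ^ (2 * N))⁻¹) / N ^ 2 *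
      ∑ r ∈ Finset.range N, ((β : ℂ) ^ 2 * (star (root N j) * root N k)) ^ (r + 1) := by
  have hN : N ≠ 0 := (Fin.pos j).ne'
  have hs : ((Real.sqrt (1 - (β ^ (2 * N))⁻¹) : ℝ) : ℂ) ^ 2 = 1 - ((β : ℂ) ^ (2 * N))⁻¹ := by
    rw [← Complex.ofReal_pow, Real.sq_sqrt (one_sub_inv_pow_pos hβ hN).le]
    push_cast; rfl
  rw [riccatiSolution, Matrix.mul_apply, ← Fin.sum_univ_eq_sum_range
    (fun r => ((β : ℂ) ^ 2 * (star (root N j) * root N k)) ^ (r + 1)), Finset.mul_sum]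
  refine Finset.sum_congr rfl fun r _ => ?_
  rw [Matrix.conjTranspose_apply, riccatiFactor, riccatiFactor, star_mul', Complex.star_def,
    Complex.conj_ofReal, ← hs, ← Complex.star_def, star_pow]
  push_cast
  rw [mul_pow, mul_pow]
  ring

/-- The constant `κ = (β^{2N} - 1)/N` with `B'G = κ B'`. -/
lemma sum_riccatiSolution {β : ℝ} (hβ : 1 < β) (k : Fin N) :
    ∑ j, riccatiSolution N β j k = ((β : ℂ) ^ (2 * N) - 1) / N := by
  have hN : N ≠ 0 := (Fin.pos k).ne'
  have hNc : (N : ℂ) ≠ 0 := by exact_mod_cast hN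
  have hβ0 : (β : ℂ) ≠ 0 := by exact_mod_cast (by linarith : β ≠ 0)
  simp only [riccatiSolution_apply hβ, ← Finset.mul_sum]
  rw [Finset.sum_comm]
  -- Among the exponents `1, …, N` only `N` survives summation over the roots of unity.
  have h : ∀ r ∈ Finset.range N,
      ∑ j, ((β : ℂ) ^ 2 * (star (root N j) * root N k)) ^ (r + 1) =
        if r = N - 1 then (β : ℂ) ^ (2 * N) * N else 0 := by
    intro r hr
    have hr := Finset.mem_range.1 hr
    have : ∀ j : Fin N, ((β : ℂ) ^ 2 * (star (root N j) * root N k)) ^ (r + 1) =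
        ((β : ℂ) ^ 2 * root N k) ^ (r + 1) * star (root N j) ^ (r + 1) := fun j => by
      rw [← mul_pow]; ring
    simp only [this, ← Finset.mul_sum]
    rw [sum_conj_root_pow]
    by_cases hr' : r = N - 1
    · have hrN : r + 1 = N := by omega
      rw [if_pos hr', hrN, if_pos dvd_rfl, mul_pow, root_pow_card, ← pow_mul]
      ring
    · rw [if_neg hr', if_neg, mul_zero]
      exact fun hd => by have := Nat.le_of_dvd (by omega) hd; omega
  rw [Finset.sum_congr rfl h, Finset.sum_ite_eq' , if_pos (Finset.mem_range.2 (by omega))]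
  field_simp

/-- The left side is an entry of `A'GA`. Multiplying the geometric series by its ratio `x` shifts
it, and `x^(N+1) = β^(2N) x`, so only a multiple of `x` is left over: the rank-one Riccati
correction. -/
lemma riccatiSolution_shift {β : ℝ} (hβ : 1 < β) (j k : Fin N) :
    (β : ℂ) ^ 2 * (star (root N j) * root N k) * riccatiSolution N β j k =
      riccatiSolution N β j k + (1 - ((β : ℂ) ^ (2 * N))⁻¹) / N ^ 2 *
        (((β : ℂ) ^ (2 * N) - 1) * ((β : ℂ) ^ 2 * (star (root N j) * root N k))) := by
  rw [riccatiSolution_apply hβ]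
  have hx : ((β : ℂ) ^ 2 * (star (root N j) * root N k)) ^ (N + 1) =
      (β : ℂ) ^ (2 * N) * ((β : ℂ) ^ 2 * (star (root N j) * root N k)) := by
    rw [pow_succ, mul_pow, mul_pow, ← star_pow, root_pow_card, root_pow_card, ← pow_mul]
    simp
  set x := (β : ℂ) ^ 2 * (star (root N j) * root N k)
  have h1 : x * ∑ r ∈ Finset.range N, x ^ (r + 1) =
      ∑ r ∈ Finset.range N, x ^ (r + 1) + (x ^ (N + 1) - x) := by
    have e1 := Finset.sum_range_succ (fun r => x ^ (r + 1)) N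
    have e2 := Finset.sum_range_succ' (fun r => x ^ (r + 1)) N
    have e3 : x * ∑ r ∈ Finset.range N, x ^ (r + 1) = ∑ r ∈ Finset.range N, x ^ (r + 1 + 1) := by
      rw [Finset.mul_sum]
      exact Finset.sum_congr rfl fun r _ => by ring
    simp only [zero_add, pow_one] at e2
    rw [e3]
    linear_combination e1 - e2
  rw [mul_left_comm, h1, hx]
  ring

lemma conjTranspose_systemB_mul_riccatiSolution {β : ℝ} (hβ : 1 < β) :
    (systemB N)ᴴ * riccatiSolution N β = Matrix.of fun _ _ => ((β : ℂ) ^ (2 * N) - 1) / N := by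
  ext i k
  rw [Matrix.mul_apply, ← sum_riccatiSolution hβ k]
  simp [systemB]

lemma inv_systemB_riccatiSolution {β : ℝ} (hβ : 1 < β) (hN : N ≠ 0) :
    ((systemB N)ᴴ * riccatiSolution N β * systemB N + 1)⁻¹ =
      ((β : ℂ) ^ (2 * N))⁻¹ • (1 : Matrix (Fin 1) (Fin 1) ℂ) := by
  have hNc : (N : ℂ) ≠ 0 := by exact_mod_cast hN
  have hβ0 : (β : ℂ) ≠ 0 := by exact_mod_cast (by linarith : β ≠ 0)
  have h : (systemB N)ᴴ * riccatiSolution N β * systemB N + 1 =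
      ((β : ℂ) ^ (2 * N)) • (1 : Matrix (Fin 1) (Fin 1) ℂ) := by
    rw [conjTranspose_systemB_mul_riccatiSolution hβ]
    ext i k
    fin_cases i; fin_cases k
    simp [Matrix.mul_apply, systemB]
    field_simp
    ring
  rw [h]
  refine Matrix.inv_eq_right_inv ?_
  rw [smul_mul_smul_comm, mul_one, mul_inv_cancel₀ (pow_ne_zero _ hβ0), one_smul]

lemma gain_riccatiSolution {β : ℝ} (hβ : 1 < β) (j : Fin N) :
    gain (symmetricA N β) (riccatiSolution N β) 0 j =
      (((1 - (β ^ (2 * N))⁻¹) / N * β : ℝ) : ℂ) * root N j := by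
  have hβ0 : (β : ℂ) ≠ 0 := by exact_mod_cast (by linarith : β ≠ 0)
  rw [gain, inv_systemB_riccatiSolution hβ (Fin.pos j).ne',
    conjTranspose_systemB_mul_riccatiSolution hβ, symmetricA_eq, Matrix.smul_mul, Matrix.one_mul,
    Matrix.smul_apply, Matrix.mul_diagonal, smul_eq_mul, Matrix.of_apply]
  push_cast
  field_simp

/-- With `κ = (β^(2N) - 1)/N`, the correction term has coefficient `κ² β^(-2N)`, exactly the excess
in `riccatiSolution_shift`. -/
lemma riccatiSolution_isDARESolution {β : ℝ} (hβ : 1 < β) :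
    IsDARESolution (symmetricA N β) (riccatiSolution N β) := by
  rw [IsDARESolution]
  ext j k
  have hN : N ≠ 0 := (Fin.pos j).ne'
  have hNc : (N : ℂ) ≠ 0 := by exact_mod_cast hN
  have hβ0 : (β : ℂ) ≠ 0 := by exact_mod_cast (by linarith : β ≠ 0)
  have hGB : riccatiSolution N β * systemB N = Matrix.of fun _ _ => ((β : ℂ) ^ (2 * N) - 1) / N := by
    have h := congrArg Matrix.conjTranspose (conjTranspose_systemB_mul_riccatiSolution (N := N) hβ)
    rw [Matrix.conjTranspose_mul, Matrix.conjTranspose_conjTranspose,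
      (riccatiSolution_posDef hβ).isHermitian.eq] at h
    rw [h]
    ext i k
    simp [Matrix.conjTranspose_apply]
  rw [inv_systemB_riccatiSolution hβ hN, conjTranspose_systemB_mul_riccatiSolution hβ,
    Matrix.mul_assoc (symmetricA N β)ᴴ (riccatiSolution N β) (systemB N), hGB, symmetricA_eq,
    Matrix.diagonal_conjTranspose, Matrix.mul_smul, Matrix.mul_one, Matrix.smul_mul,
    Matrix.sub_apply, Matrix.mul_diagonal, Matrix.diagonal_mul, Matrix.smul_apply, Matrix.mul_apply]
  simp only [Finset.univ_unique, Finset.sum_singleton, Matrix.mul_diagonal, Matrix.diagonal_mul,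
    Matrix.of_apply, Pi.star_apply, star_mul', Complex.star_def, Complex.conj_ofReal, smul_eq_mul]
  have h := riccatiSolution_shift hβ j k
  rw [Complex.star_def] at h
  rw [show (β : ℂ) * (starRingEnd ℂ) (root N j) * riccatiSolution N β j k * (β * root N k) =
    (β : ℂ) ^ 2 * ((starRingEnd ℂ) (root N j) * root N k) * riccatiSolution N β j k by ring, h]
  field_simp
  ring

/-- The inverse of an invertible solution of the Riccati equation satisfies a Lyapunov equation. -/
lemma lyapunov_of_riccati {A G : Matrix (Fin N) (Fin N) ℂ} {B : Matrix (Fin N) (Fin 1) ℂ}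
    {M : Matrix (Fin 1) (Fin 1) ℂ} (hAu : IsUnit A.det) (hGu : IsUnit G.det) (hMu : IsUnit M.det)
    (hM : Bᴴ * G * B = M - 1)
    (hD : G = Aᴴ * G * A - Aᴴ * G * B * M⁻¹ * (Bᴴ * G * A)) :
    A * G⁻¹ * Aᴴ = G⁻¹ + B * Bᴴ := by
  -- By the Woodbury identity `Q` is the inverse of `G⁻¹ + BB'`; by the Riccati equation `A'QA = G`,
  -- so it is also the inverse of `A G⁻¹ A'`.
  obtain ⟨Q, hQdef⟩ : ∃ Q, Q = G - G * B * M⁻¹ * (Bᴴ * G) := ⟨_, rfl⟩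
  have hQ : Aᴴ * Q * A = G := by
    refine Eq.trans ?_ hD.symm
    simp only [hQdef, Matrix.mul_sub, Matrix.sub_mul, Matrix.mul_assoc]
  have hQW : Q * (G⁻¹ + B * Bᴴ) = 1 := by
    have e1 : G * B * M⁻¹ * (Bᴴ * G) * G⁻¹ = G * B * M⁻¹ * Bᴴ := by
      rw [Matrix.mul_assoc _ (Bᴴ * G), Matrix.mul_nonsing_inv_cancel_right _ _ hGu]
    have e2 : G * B * M⁻¹ * (Bᴴ * G) * (B * Bᴴ) = G * B * Bᴴ - G * B * M⁻¹ * Bᴴ := by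
      calc G * B * M⁻¹ * (Bᴴ * G) * (B * Bᴴ) = G * B * M⁻¹ * (Bᴴ * G * B) * Bᴴ := by
            simp only [Matrix.mul_assoc]
        _ = _ := by
            rw [hM, Matrix.mul_sub, Matrix.nonsing_inv_mul_cancel_right _ _ hMu, Matrix.mul_one,
              Matrix.sub_mul]
    rw [hQdef, Matrix.mul_add, Matrix.sub_mul, Matrix.sub_mul, e1, e2,
      Matrix.mul_nonsing_inv _ hGu, ← Matrix.mul_assoc]
    abel
  have hQA : (A * G⁻¹ * Aᴴ) * Q = 1 := by
    have e : A * G⁻¹ * (Aᴴ * Q * A) * A⁻¹ = 1 := by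
      rw [hQ, Matrix.nonsing_inv_mul_cancel_right _ _ hGu, Matrix.mul_nonsing_inv _ hAu]
    rw [← e]
    simp only [← Matrix.mul_assoc]
    rw [Matrix.mul_nonsing_inv_cancel_right _ _ hAu]
  exact left_inv_eq_right_inv hQA hQW

lemma lyapunov_of_isPosDefDARESolution {A G : Matrix (Fin N) (Fin N) ℂ} (hA : IsUnit A)
    (h : IsPosDefDARESolution A G) :
    A * G⁻¹ * Aᴴ = G⁻¹ + systemB N * (systemB N)ᴴ := by
  refine lyapunov_of_riccati ((Matrix.isUnit_iff_isUnit_det _).1 hA)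
    ((Matrix.isUnit_iff_isUnit_det _).1 h.1.isUnit) ?_ (add_sub_cancel_right _ _).symm h.2
  exact (Matrix.isUnit_iff_isUnit_det _).1 (Matrix.PosDef.isUnit
    (Matrix.PosDef.posSemidef_add (h.1.posSemidef.conjTranspose_mul_mul_same _) Matrix.PosDef.one))

lemma isUnit_symmetricA {β : ℝ} (hβ : 1 < β) : IsUnit (symmetricA N β) := by
  have hβ0 : (β : ℂ) ≠ 0 := by exact_mod_cast (by linarith : β ≠ 0)
  rw [Matrix.isUnit_iff_isUnit_det, symmetricA_eq, Matrix.det_diagonal, isUnit_iff_ne_zero]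
  exact Finset.prod_ne_zero_iff.2 fun j _ => mul_ne_zero hβ0 (root_ne_zero j)

/-- As `A` is diagonal, the Lyapunov equation for the inverse decouples into one scalar equation per
entry, whose coefficient is nonzero because `β² ω_j conj(ω_k)` has modulus `β² > 1`. -/
lemma isPosDefDARESolution_unique {β : ℝ} (hβ : 1 < β) {G G' : Matrix (Fin N) (Fin N) ℂ}
    (h : IsPosDefDARESolution (symmetricA N β) G)
    (h' : IsPosDefDARESolution (symmetricA N β) G') : G = G' := by
  have key : ∀ {H : Matrix (Fin N) (Fin N) ℂ}, IsPosDefDARESolution (symmetricA N β) H →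
      ∀ j k, ((β : ℂ) ^ 2 * (root N j * star (root N k)) - 1) * H⁻¹ j k = 1 := by
    intro H hH j k
    have e := congrFun (congrFun (lyapunov_of_isPosDefDARESolution (isUnit_symmetricA hβ) hH) j) k
    rw [symmetricA_eq, Matrix.diagonal_conjTranspose, Matrix.mul_diagonal, Matrix.diagonal_mul,
      Matrix.add_apply, Matrix.mul_apply] at e
    simp only [Pi.star_apply, star_mul', Complex.star_def, Complex.conj_ofReal, systemB,
      Matrix.conjTranspose_apply, map_one, mul_one, Finset.univ_unique, Finset.sum_singleton] at e
    rw [Complex.star_def]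
    linear_combination e
  have hinv : G⁻¹ = G'⁻¹ := by
    ext j k
    have hne : (β : ℂ) ^ 2 * (root N j * star (root N k)) - 1 ≠ 0 := by
      intro h0
      have h1 := congrArg norm (sub_eq_zero.1 h0)
      rw [norm_mul, norm_mul, norm_star, norm_root, norm_root, norm_pow, Complex.norm_real,
        norm_one, mul_one, mul_one, Real.norm_eq_abs, sq_abs] at h1
      nlinarith
    exact mul_left_cancel₀ hne ((key h j k).trans (key h' j k).symm)
  have hu : IsUnit G.det := (Matrix.isUnit_iff_isUnit_det _).1 h.1.isUnit
  have hu' : IsUnit G'.det := (Matrix.isUnit_iff_isUnit_det _).1 h'.1.isUnit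
  rw [← Matrix.nonsing_inv_nonsing_inv G hu, hinv, Matrix.nonsing_inv_nonsing_inv G' hu']

lemma riccatiSolution_isPosDefDARESolution {β : ℝ} (hβ : 1 < β) :
    IsPosDefDARESolution (symmetricA N β) (riccatiSolution N β) :=
  ⟨riccatiSolution_posDef hβ, riccatiSolution_isDARESolution hβ⟩

end Riccati

/-! ### The power function and its equivalence with the equation for `φ`. -/

section Kramer

/-- The asymptotic power per sender of the optimal linear code, as a function of `b = β²`. -/
noncomputable def senderPower (N : ℕ) (b : ℝ) : ℝ :=
  (∑ k ∈ Finset.range N, b ^ k) * (b - (b ^ (N - 1))⁻¹) / (N : ℝ) ^ 2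

variable {N : ℕ} {b P φ : ℝ}

lemma senderPower_eq_iff (hN : 1 ≤ N) (hb : 0 < b) :
    senderPower N b = P ↔
      P * b ^ (N - 1) * (N : ℝ) ^ 2 = (∑ k ∈ Finset.range N, b ^ k) * (b ^ N - 1) := by
  have hN' : (0 : ℝ) < N := by exact_mod_cast hN
  have hpow : b ^ N = b * b ^ (N - 1) := by rw [← pow_succ', Nat.sub_add_cancel hN]
  have hbm : 0 < b ^ (N - 1) := by positivity
  rw [senderPower, div_eq_iff (by positivity), hpow]
  generalize b ^ (N - 1) = m at hbm
  generalize ∑ k ∈ Finset.range N, b ^ k = S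
  have hm : m⁻¹ * m = 1 := inv_mul_cancel₀ hbm.ne'
  constructor
  · intro h
    linear_combination -m * h - S * hm
  · intro h
    apply mul_right_cancel₀ hbm.ne'
    linear_combination -h - S * hm

lemma geom_sum_pos' (hN : 1 ≤ N) (hb : 0 < b) : 0 < ∑ k ∈ Finset.range N, b ^ k :=
  Finset.sum_pos (fun k _ => pow_pos hb k) ⟨0, Finset.mem_range.2 hN⟩

lemma senderPower_strictMonoOn (hN : 1 ≤ N) : StrictMonoOn (senderPower N) (Set.Ici 1) := by
  intro x hx y hy hxy
  have hx : (1 : ℝ) ≤ x := hx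
  have hN' : (0 : ℝ) < N := by exact_mod_cast hN
  have hx0 : 0 < x := by linarith
  rw [senderPower, senderPower]
  refine div_lt_div_of_pos_right ?_ (by positivity)
  have hinv : (y ^ (N - 1))⁻¹ ≤ (x ^ (N - 1))⁻¹ := by gcongr
  have hinv1 : (x ^ (N - 1))⁻¹ ≤ 1 := inv_le_one_of_one_le₀ (one_le_pow₀ hx)
  refine mul_lt_mul' (Finset.sum_le_sum fun k _ => by gcongr) (by linarith) (by linarith)
    (geom_sum_pos' hN (by linarith))

lemma senderPower_one : senderPower N 1 = 0 := by simp [senderPower]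

lemma senderPower_pos (hN : 1 ≤ N) (hb : 1 < b) : 0 < senderPower N b := by
  rw [← senderPower_one (N := N)]
  exact senderPower_strictMonoOn hN (by simp) hb.le hb

lemma exists_senderPower_eq (hN : 1 ≤ N) (hP : 0 < P) : ∃ b, 1 < b ∧ senderPower N b = P := by
  have hN' : (0 : ℝ) < N := by exact_mod_cast hN
  have hle : (1 : ℝ) ≤ 1 + (N : ℝ) ^ 2 * P := by
    have : 0 < (N : ℝ) ^ 2 * P := by positivity
    linarith
  have hcont : ContinuousOn (senderPower N) (Set.Icc 1 (1 + (N : ℝ) ^ 2 * P)) := by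
    unfold senderPower
    refine ContinuousOn.div_const (ContinuousOn.mul (by fun_prop) (continuousOn_id.sub
      (ContinuousOn.inv₀ (by fun_prop) fun x hx => pow_ne_zero _ ?_))) _
    have := hx.1
    linarith
  -- At `c = 1 + N²P` the geometric sum is at least `1` and `c^(-(N-1)) ≤ 1`, so the numerator is at
  -- least `N²P`.
  have hbig : P ≤ senderPower N (1 + (N : ℝ) ^ 2 * P) := by
    set c := 1 + (N : ℝ) ^ 2 * P with hc
    have h1 : (1 : ℝ) ≤ ∑ k ∈ Finset.range N, c ^ k :=
      (pow_zero c).symm.le.trans (Finset.single_le_sum (f := fun k => c ^ k)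
        (fun k _ => by positivity) (Finset.mem_range.2 hN))
    have h2 : (c ^ (N - 1))⁻¹ ≤ 1 := inv_le_one_of_one_le₀ (one_le_pow₀ hle)
    rw [senderPower, le_div_iff₀ (by positivity)]
    nlinarith
  obtain ⟨b, hb, hbP⟩ := intermediate_value_Icc hle hcont
    ⟨by rw [senderPower_one]; exact hP.le, hbig⟩
  refine ⟨b, lt_of_le_of_ne hb.1 ?_, hbP⟩
  rintro rfl
  rw [senderPower_one] at hbP
  exact hP.ne hbP

/-- With `S = ∑ b^k`, the power equation reads `φ = N b^(N-1) / S`, so `1 ≤ φ ≤ N` amounts to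
`b^(N-1) ≤ S ≤ N b^(N-1)`. It also gives `P φ² = b^(N-1) (b - 1)`, hence `1 + P φ (N - φ) =
b^(N-1)`, and both sides of the equation for `φ` are `b^(N(N-1))`. -/
lemma isKramerPhi_of_senderPower_eq (hN : 1 ≤ N) (hP : 0 < P) (hb : 1 < b)
    (h : senderPower N b = P) : IsKramerPhi N P ((b ^ N - 1) / (N * P)) := by
  have hb0 : 0 < b := by linarith
  have hN' : (0 : ℝ) < N := by exact_mod_cast hN
  rw [senderPower_eq_iff hN hb0] at h
  obtain ⟨S, hS⟩ : ∃ S, S = ∑ k ∈ Finset.range N, b ^ k := ⟨_, rfl⟩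
  have hSb : S * (b - 1) = b ^ N - 1 := by rw [hS, geom_sum_mul]
  have hS0 : 0 < S := hS ▸ geom_sum_pos' hN hb0
  have hm0 : 0 < b ^ (N - 1) := by positivity
  have hSle : S ≤ N * b ^ (N - 1) := by
    rw [hS]
    calc ∑ k ∈ Finset.range N, b ^ k ≤ ∑ _k ∈ Finset.range N, b ^ (N - 1) :=
          Finset.sum_le_sum fun k hk =>
            pow_le_pow_right₀ hb.le (by have := Finset.mem_range.1 hk; omega)
      _ = _ := by simp
  have hleS : b ^ (N - 1) ≤ S := by
    rw [hS]
    exact Finset.single_le_sum (f := fun k => b ^ k) (fun k _ => by positivity)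
      (Finset.mem_range.2 (by omega : N - 1 < N))
  rw [← hS] at h
  have hpow : b ^ N = b * b ^ (N - 1) := by rw [← pow_succ', Nat.sub_add_cancel hN]
  have hφ : (b ^ N - 1) / (N * P) = N * b ^ (N - 1) / S := by
    rw [div_eq_div_iff (by positivity) hS0.ne']
    linear_combination -h
  have hφ1 : 1 + N * P * ((b ^ N - 1) / (N * P)) = b ^ N := by field_simp; ring
  have hφ2 : P * ((b ^ N - 1) / (N * P)) ^ 2 = b ^ (N - 1) * (b - 1) := by
    rw [hφ, div_pow, mul_div_assoc', div_eq_iff (by positivity)]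
    linear_combination b ^ (N - 1) * h - S * b ^ (N - 1) * hSb
  refine ⟨⟨?_, ?_⟩, ?_⟩
  · rw [hφ, le_div_iff₀ hS0]; linarith
  · rw [hφ, div_le_iff₀ hS0]; gcongr
  · have h3 : 1 + P * ((b ^ N - 1) / (N * P)) * (N - (b ^ N - 1) / (N * P)) = b ^ (N - 1) := by
      linear_combination hφ1 - hφ2 + hpow
    rw [hφ1, h3, ← pow_mul, ← pow_mul, mul_comm]

/-- Take `b` to be the `N`-th root of `1 + N P φ`. Since `φ ≤ N`, the other base is nonnegative, so
`N`-th roots give `1 + P φ (N - φ) = b^(N-1)`; subtracting yields `P φ² = b^(N-1) (b - 1)`. -/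
lemma exists_of_isKramerPhi (hN : 1 ≤ N) (hP : 0 < P) (h : IsKramerPhi N P φ) :
    ∃ b, 1 < b ∧ senderPower N b = P ∧ b ^ N = 1 + N * P * φ := by
  obtain ⟨⟨h1, h2⟩, h3⟩ := h
  have hN' : (0 : ℝ) < N := by exact_mod_cast hN
  have hφ : 0 < φ := by linarith
  have hgt : 1 < 1 + N * P * φ := by
    have : 0 < N * P * φ := by positivity
    linarith
  obtain ⟨b, hbdef⟩ : ∃ b, b = (1 + N * P * φ) ^ ((1 : ℝ) / N) := ⟨_, rfl⟩
  have hb : 1 < b := hbdef ▸ Real.one_lt_rpow hgt (by positivity)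
  have hbN : b ^ N = 1 + N * P * φ := by
    rw [hbdef, ← Real.rpow_natCast, ← Real.rpow_mul (by linarith), one_div,
      inv_mul_cancel₀ hN'.ne', Real.rpow_one]
  have hb0 : 0 < b := by linarith
  refine ⟨b, hb, ?_, hbN⟩
  have hm : b ^ (N - 1) = 1 + P * φ * (N - φ) := by
    have hnn : 0 ≤ 1 + P * φ * (N - φ) := by
      have : 0 ≤ P * φ * (N - φ) := mul_nonneg (by positivity) (by linarith)
      linarith
    refine (pow_left_inj₀ (by positivity) hnn (by omega : N ≠ 0)).1 ?_
    rw [← h3, ← hbN, ← pow_mul, ← pow_mul, mul_comm]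
  rw [senderPower_eq_iff hN hb0]
  have hSb := geom_sum_mul b N
  have hpow : b ^ N = b * b ^ (N - 1) := by rw [← pow_succ', Nat.sub_add_cancel hN]
  have hP2 : P * φ ^ 2 = b ^ (N - 1) * (b - 1) := by
    linear_combination hm - hbN + hpow
  have hbm1 : b - 1 ≠ 0 := by linarith
  apply mul_right_cancel₀ hbm1
  rw [mul_assoc, mul_assoc]
  set S := ∑ k ∈ Finset.range N, b ^ k
  have e : b ^ N - 1 = N * P * φ := by linarith
  calc P * (b ^ (N - 1) * ((N : ℝ) ^ 2 * (b - 1))) = P * N ^ 2 * (b ^ (N - 1) * (b - 1)) := by ring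
    _ = (N * P * φ) ^ 2 := by rw [← hP2]; ring
    _ = S * (b - 1) * (b ^ N - 1) := by rw [hSb, e]; ring
    _ = _ := by ring

lemma existsUnique_isKramerPhi (hN : 1 ≤ N) (hP : 0 < P) : ∃! φ, IsKramerPhi N P φ := by
  have hN' : (0 : ℝ) < N := by exact_mod_cast hN
  obtain ⟨b, hb, hbP⟩ := exists_senderPower_eq hN hP
  refine ⟨_, isKramerPhi_of_senderPower_eq hN hP hb hbP, fun φ hφ => ?_⟩
  obtain ⟨c, hc, hcP, hcN⟩ := exists_of_isKramerPhi hN hP hφ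
  have : c = b := (senderPower_strictMonoOn hN).injOn hc.le hb.le (hcP.trans hbP.symm)
  rw [← this, hcN]
  field_simp
  ring

end Kramer

/-! ### Size and energy of the closed-loop impulse response. -/

section Impulse

/-- The modulus of the impulse response of the optimal closed loop. -/
noncomputable def impulse (N : ℕ) (β : ℝ) (m : ℕ) : ℝ := β ^ m / β ^ (2 * N * (m / N))

variable {N : ℕ} {β : ℝ}

lemma impulse_nonneg (hβ : 1 < β) (m : ℕ) : 0 ≤ impulse N β m := by
  unfold impulse; positivity

lemma impulse_zero : impulse N β 0 = 1 := by simp [impulse]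

lemma impulse_of_lt {m : ℕ} (hm : m < N) : impulse N β m = β ^ m := by
  simp [impulse, Nat.div_eq_of_lt hm]

lemma impulse_succ_of_dvd (hβ : 1 < β) {m : ℕ} (h : N ∣ m + 1) :
    impulse N β (m + 1) = β * impulse N β m * (β ^ (2 * N))⁻¹ := by
  have hβ0 : β ≠ 0 := by linarith
  rw [impulse, impulse, Nat.succ_div_of_dvd h, mul_add, pow_add _ _ (2 * N * 1), mul_one, pow_succ]
  field_simp

lemma impulse_succ_of_not_dvd {m : ℕ} (h : ¬ N ∣ m + 1) :
    impulse N β (m + 1) = β * impulse N β m := by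
  rw [impulse, impulse, Nat.succ_div_of_not_dvd h, pow_succ]
  ring

lemma impulse_mul_add (hβ : 1 < β) (q : ℕ) {t : ℕ} (ht : t < N) :
    impulse N β (N * q + t) ^ 2 = (((β ^ 2) ^ N)⁻¹) ^ q * (β ^ 2) ^ t := by
  have hβ0 : β ≠ 0 := by linarith
  have h : (N * q + t) / N = q := by
    rw [Nat.mul_add_div (by omega), Nat.div_eq_of_lt ht, add_zero]
  rw [impulse, h, div_pow, div_eq_iff (by positivity), inv_pow, ← pow_mul, ← pow_mul, ← pow_mul,
    ← pow_mul, ← pow_mul, mul_comm, eq_comm, mul_assoc, ← div_eq_inv_mul,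
    ← pow_add, div_eq_iff (by positivity), ← pow_add]
  congr 1
  ring

lemma sum_range_mul_impulse_sq (hβ : 1 < β) (Q : ℕ) :
    ∑ m ∈ Finset.range (N * Q), impulse N β m ^ 2 =
      (∑ q ∈ Finset.range Q, (((β ^ 2) ^ N)⁻¹) ^ q) * ∑ t ∈ Finset.range N, (β ^ 2) ^ t := by
  induction Q with
  | zero => simp
  | succ Q ih =>
    rw [Nat.mul_succ, Finset.sum_range_add, ih, Finset.sum_range_succ, add_mul]
    congr 1
    rw [Finset.mul_sum]
    exact Finset.sum_congr rfl fun t ht => impulse_mul_add hβ Q (Finset.mem_range.1 ht)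

/-- The stationary second moment of each mode. -/
noncomputable def stationaryMoment (N : ℕ) (β : ℝ) : ℝ := (β ^ 2) ^ N / (β ^ 2 - 1)

lemma one_lt_sq (hβ : 1 < β) : 1 < β ^ 2 := one_lt_pow₀ hβ two_ne_zero

lemma stationaryMoment_pos (hβ : 1 < β) : 0 < stationaryMoment N β := by
  have := one_lt_sq hβ
  exact div_pos (by positivity) (by linarith)

lemma monotone_sum_impulse_sq :
    Monotone fun n => ∑ m ∈ Finset.range n, impulse N β m ^ 2 :=
  fun _ _ hab => Finset.sum_le_sum_of_subset_of_nonneg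
    (Finset.range_mono hab) fun _ _ _ => sq_nonneg _

/-- Partial sums are monotone, so lengths that are multiples of `N` suffice. There the sum is a
geometric series of ratio `β^(-2N)` over blocks, times a finite geometric sum of ratio `β²` within a
block. -/
lemma tendsto_sum_impulse_sq (hN : 1 ≤ N) (hβ : 1 < β) :
    Tendsto (fun n => ∑ m ∈ Finset.range n, impulse N β m ^ 2) atTop
      (𝓝 (stationaryMoment N β)) := by
  have hb := one_lt_sq hβ
  have hsub : Tendsto (fun Q : ℕ => N * Q) atTop atTop :=
    tendsto_id.const_mul_atTop' (by omega)
  refine (tendsto_iff_tendsto_subseq_of_monotone monotone_sum_impulse_sq hsub).2 ?_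
  have hbN : 1 < (β ^ 2) ^ N := one_lt_pow₀ hb (by omega)
  have hgeo := (hasSum_geometric_of_lt_one (by positivity)
    (inv_lt_one_of_one_lt₀ hbN)).tendsto_sum_nat
  have := hgeo.mul_const (∑ t ∈ Finset.range N, (β ^ 2) ^ t)
  convert this using 1
  · ext Q
    exact sum_range_mul_impulse_sq hβ Q
  · congr 1
    rw [geom_sum_eq hb.ne', stationaryMoment]
    have h1 : β ^ 2 - 1 ≠ 0 := by linarith
    have h2 : (β ^ 2) ^ N - 1 ≠ 0 := by linarith
    have h4 : 1 - ((β ^ 2) ^ N)⁻¹ ≠ 0 := by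
      have := inv_lt_one_of_one_lt₀ hbN
      linarith
    field_simp

lemma sum_impulse_sq_le (hN : 1 ≤ N) (hβ : 1 < β) (n : ℕ) :
    ∑ m ∈ Finset.range n, impulse N β m ^ 2 ≤ stationaryMoment N β :=
  monotone_sum_impulse_sq.ge_of_tendsto (tendsto_sum_impulse_sq hN hβ) n

lemma tendsto_impulse (hN : 1 ≤ N) (hβ : 1 < β) : Tendsto (impulse N β) atTop (𝓝 0) := by
  have h := tendsto_sum_impulse_sq hN hβ
  have h2 : Tendsto (fun m => impulse N β m ^ 2) atTop (𝓝 0) := by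
    have h1 := (h.comp (tendsto_add_atTop_nat 1)).sub h
    rw [sub_self] at h1
    refine h1.congr fun m => ?_
    rw [Function.comp_apply, Finset.sum_range_succ, add_sub_cancel_left]
  have h3 := h2.sqrt
  rw [Real.sqrt_zero] at h3
  exact h3.congr fun m => Real.sqrt_sq (impulse_nonneg hβ m)

end Impulse

/-! ### Closed-loop state, its stationary second moment and the sender powers. -/

section ClosedLoop

variable {N : ℕ} {β : ℝ}

lemma symmetricA_mulVec (s : Fin N → ℂ) (j : Fin N) :
    (symmetricA N β *ᵥ s) j = β * root N j * s j := by
  rw [symmetricA_eq, Matrix.mulVec_diagonal]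

lemma systemB_mulVec (y : ℂ) (j : Fin N) : (systemB N *ᵥ fun _ => y) j = y := by
  simp [Matrix.mulVec, dotProduct, systemB]

lemma state_succ (π : Controller N) (s₀ : Fin N → ℂ) (z : ℕ → ℂ) (i : ℕ) (j : Fin N) :
    state (symmetricA N β) π s₀ z (i + 1) j =
      β * root N j * state (symmetricA N β) π s₀ z i j +
        output (symmetricA N β) π s₀ z i := by
  rw [state, Pi.add_apply, symmetricA_mulVec, systemB_mulVec, output]

/-- The modulus of the optimal gains. -/
noncomputable def gainModulus (N : ℕ) (β : ℝ) : ℝ := (1 - (β ^ (2 * N))⁻¹) / N * β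

/-- The optimal controller of the symmetric system. -/
noncomputable def optController (N : ℕ) (β : ℝ) : Controller N :=
  dareController (symmetricA N β) (riccatiSolution N β)

lemma optController_apply (hβ : 1 < β) (j : Fin N) (i : ℕ) (s : ℂ) :
    optController N β j i s = -(gainModulus N β * root N j * s) := by
  rw [optController, dareController, linearController, gain_riccatiSolution hβ, gainModulus]

/-- The impulse response of the optimal closed loop. -/
noncomputable def response (N : ℕ) (β : ℝ) (m : ℕ) (j : Fin N) : ℂ :=
  impulse N β m * root N j ^ m

lemma norm_response (hβ : 1 < β) (m : ℕ) (j : Fin N) : ‖response N β m j‖ = impulse N β m := by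
  rw [response, norm_mul, norm_pow, norm_root, one_pow, mul_one, Complex.norm_real,
    Real.norm_of_nonneg (impulse_nonneg hβ m)]

/-- The feedback term contains `∑ ω_k^(m+1)`, which vanishes unless `N ∣ m + 1`; then all modes are
in phase, and the feedback turns the factor `β` into `β · β^(-2N)`. -/
lemma closedLoop_response (hβ : 1 < β) (m : ℕ) (j : Fin N) :
    β * root N j * response N β m j - gainModulus N β * ∑ k, root N k * response N β m k =
      response N β (m + 1) j := by
  have hNc : (N : ℂ) ≠ 0 := by exact_mod_cast (Fin.pos j).ne'
  have h : ∑ k, root N k * response N β m k = impulse N β m * ∑ k, root N k ^ (m + 1) := by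
    rw [Finset.mul_sum]
    exact Finset.sum_congr rfl fun k _ => by rw [response]; ring
  rw [h, sum_root_pow, response, response]
  split_ifs with hd
  · have h1 := root_pow_eq_one_of_dvd j hd
    rw [h1, impulse_succ_of_dvd hβ hd]
    rw [pow_succ] at h1
    have h2 : (β : ℂ) * root N j * (impulse N β m * root N j ^ m) = β * impulse N β m := by
      linear_combination (β * impulse N β m : ℂ) * h1
    rw [h2, gainModulus]
    push_cast
    field_simp
    ring
  · rw [impulse_succ_of_not_dvd hd]
    push_cast
    ring

lemma closedLoop_sum_response (hβ : 1 < β) {ι : Type*} (S : Finset ι) (a : ι → ℂ) (m : ι → ℕ)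
    (j : Fin N) :
    β * root N j * (∑ i ∈ S, a i * response N β (m i) j) -
        gainModulus N β * ∑ k, root N k * ∑ i ∈ S, a i * response N β (m i) k =
      ∑ i ∈ S, a i * response N β (m i + 1) j := by
  simp only [Finset.mul_sum]
  rw [Finset.sum_comm, ← Finset.sum_sub_distrib]
  refine Finset.sum_congr rfl fun i _ => ?_
  rw [← closedLoop_response hβ, mul_sub, Finset.mul_sum, Finset.mul_sum]
  congr 1
  · ring
  · exact Finset.sum_congr rfl fun k _ => by ring

lemma output_optController (hβ : 1 < β) (s₀ : Fin N → ℂ) (z : ℕ → ℂ) {i : ℕ} (hi : i ≠ 0) :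
    output (symmetricA N β) (optController N β) s₀ z i =
      -(gainModulus N β * ∑ k, root N k *
        state (symmetricA N β) (optController N β) s₀ z i k) + z i := by
  rw [output, outputOf, if_neg hi]
  congr 1
  simp only [optController_apply hβ]
  rw [Finset.sum_neg_distrib, Finset.mul_sum]
  simp only [mul_assoc]

/-- Coordinates of the state at time `1` with respect to the first `N` impulse responses. -/
noncomputable def initialCoeff (β : ℝ) (s₀ : Fin N → ℂ) (t : ℕ) : ℂ :=
  (∑ k, star (root N k) ^ t * (β * root N k * s₀ k)) / N / (β : ℂ) ^ t

/-- The part of the state at time `n + 1` due to the initial state. -/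
noncomputable def initialResponse (β : ℝ) (s₀ : Fin N → ℂ) (n : ℕ) (j : Fin N) : ℂ :=
  ∑ t ∈ Finset.range N, initialCoeff β s₀ t * response N β (n + t) j

/-- Superposition: the closed loop advances every response by one index, and each noise sample
starts a new one. Since `Y₀ = 0`, the state at time `1` is `A s₀`, which Fourier inversion expands
in the first `N` responses; this is why times are written `n + 1`. -/
lemma state_optController (hβ : 1 < β) (s₀ : Fin N → ℂ) (z : ℕ → ℂ) (n : ℕ) (j : Fin N) :
    state (symmetricA N β) (optController N β) s₀ z (n + 1) j =
      initialResponse β s₀ n j +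
        ∑ k ∈ Finset.range n, z (k + 1) * response N β (n - 1 - k) j := by
  induction n generalizing j with
  | zero =>
    have hβ0 : (β : ℂ) ≠ 0 := by exact_mod_cast (by linarith : β ≠ 0)
    rw [state_succ, state, output, outputOf, if_pos rfl, Finset.sum_range_zero, add_zero, add_zero,
      ← fourier_inversion (fun k => β * root N k * s₀ k) j, initialResponse]
    refine Finset.sum_congr rfl fun t ht => ?_
    rw [initialCoeff, response, zero_add, impulse_of_lt (Finset.mem_range.1 ht)]
    push_cast
    rw [← mul_assoc, div_mul_cancel₀ _ (pow_ne_zero _ hβ0), mul_comm]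
  | succ n ih =>
    rw [state_succ, output_optController hβ _ _ n.succ_ne_zero]
    simp only [ih]
    have h1 := closedLoop_sum_response hβ (Finset.range N) (initialCoeff β s₀) (fun t => n + t) j
    have h2 := closedLoop_sum_response hβ (Finset.range n) (fun k => z (k + 1))
      (fun k => n - 1 - k) j
    have h3 : ∑ k ∈ Finset.range (n + 1), z (k + 1) * response N β (n + 1 - 1 - k) j =
        ∑ k ∈ Finset.range n, z (k + 1) * response N β (n - 1 - k + 1) j + z (n + 1) := by
      rw [Finset.sum_range_succ, Nat.add_sub_cancel, Nat.sub_self]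
      congr 1
      · refine Finset.sum_congr rfl fun k hk => ?_
        have := Finset.mem_range.1 hk
        rw [show n - 1 - k + 1 = n - k by omega]
      · simp [response, impulse_zero]
    have h4 : initialResponse β s₀ (n + 1) j =
        ∑ t ∈ Finset.range N, initialCoeff β s₀ t * response N β (n + t + 1) j := by
      refine Finset.sum_congr rfl fun t _ => ?_
      rw [add_right_comm]
    rw [h3, h4, ← h1, ← h2]
    simp only [initialResponse, mul_add, Finset.sum_add_distrib]
    ring

lemma measurable_optController (j : Fin N) (i : ℕ) : Measurable (optController N β j i) := by
  unfold optController dareController linearController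
  fun_prop

lemma measurable_state {π : Controller N} (hπ : ∀ j i, Measurable (π j i)) (n : ℕ) (j : Fin N) :
    Measurable fun p : (Fin N → ℂ) × (ℕ → ℂ) => state (symmetricA N β) π p.1 p.2 n j := by
  induction n generalizing j with
  | zero => simp only [state]; fun_prop
  | succ n ih =>
    simp only [state_succ, output, outputOf]
    refine ((ih j).const_mul _).add ?_
    split_ifs
    · exact measurable_const
    · refine (Finset.measurable_fun_sum _ fun k _ => (hπ k n).comp (ih k)).add ?_
      fun_prop

/-- A bound on the transient. -/
noncomputable def transient (N : ℕ) (β : ℝ) (n : ℕ) : ℝ :=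
  ∑ t ∈ Finset.range N, 2 * β * impulse N β (n + t)

lemma tendsto_transient (hN : 1 ≤ N) (hβ : 1 < β) : Tendsto (transient N β) atTop (𝓝 0) := by
  have : Tendsto (transient N β) atTop (𝓝 (∑ t ∈ Finset.range N, 2 * β * 0)) :=
    tendsto_finsetSum _ fun t _ => ((tendsto_impulse hN hβ).comp
      (tendsto_add_atTop_nat t)).const_mul _
  simpa using this

/-- The bound `2` holds on the unit square, so the resulting transient estimate is uniform over
uniform messages and all discrete message sets. -/
lemma norm_initialCoeff_le (hβ : 1 < β) {s₀ : Fin N → ℂ} (hs : ∀ k, ‖s₀ k‖ ≤ 2) (t : ℕ) :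
    ‖initialCoeff β s₀ t‖ ≤ 2 * β := by
  rcases Nat.eq_zero_or_pos N with rfl | hN
  · simp [initialCoeff]; linarith
  have hN' : (0 : ℝ) < N := by exact_mod_cast hN
  have h1 : ‖∑ k, star (root N k) ^ t * (β * root N k * s₀ k)‖ ≤ N * (2 * β) := by
    refine (norm_sum_le _ _).trans ?_
    calc _ ≤ ∑ _k : Fin N, 2 * β := Finset.sum_le_sum fun k _ => by
          rw [norm_mul, norm_mul, norm_mul, norm_pow, norm_star, norm_root, Complex.norm_real,
            Real.norm_of_nonneg (by linarith), one_pow, one_mul, mul_one, mul_comm]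
          exact mul_le_mul_of_nonneg_right (hs k) (by linarith)
      _ = _ := by simp
  rw [initialCoeff, norm_div, norm_div, norm_pow, Complex.norm_natCast, Complex.norm_real,
    Real.norm_of_nonneg (by linarith)]
  refine (div_le_self (by positivity) (one_le_pow₀ hβ.le)).trans ?_
  rwa [div_le_iff₀ hN', mul_comm]

lemma norm_initialResponse_le (hβ : 1 < β) {s₀ : Fin N → ℂ} (hs : ∀ k, ‖s₀ k‖ ≤ 2) (n : ℕ)
    (j : Fin N) : ‖initialResponse β s₀ n j‖ ≤ transient N β n := by
  refine (norm_sum_le _ _).trans (Finset.sum_le_sum fun t _ => ?_)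
  rw [norm_mul, norm_response hβ]
  exact mul_le_mul_of_nonneg_right (norm_initialCoeff_le hβ hs t) (impulse_nonneg hβ _)

lemma lintegral_state_sq (hβ : 1 < β) (s₀ : Fin N → ℂ) (n : ℕ) (j : Fin N) :
    ∫⁻ z, ‖state (symmetricA N β) (optController N β) s₀ z (n + 1) j‖ₑ ^ 2 ∂noiseLaw =
      ‖initialResponse β s₀ n j‖ₑ ^ 2 +
        ENNReal.ofReal (∑ m ∈ Finset.range n, impulse N β m ^ 2) := by
  simp only [state_optController hβ]
  rw [lintegral_const_add_sum_noise _ (fun k => response N β (n - 1 - k) j),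
    Finset.sum_range_reflect (fun k => ‖response N β k j‖ₑ ^ 2),
    ENNReal.ofReal_sum_of_nonneg fun _ _ => sq_nonneg _]
  congr 1
  exact Finset.sum_congr rfl fun k _ => by rw [enorm_sq_eq_ofReal, norm_response hβ]

/-- `E |S_n(j)|²`. -/
noncomputable def stateMoment (A : Matrix (Fin N) (Fin N) ℂ) (π : Controller N)
    (ρ : Measure (Fin N → ℂ)) (n : ℕ) (j : Fin N) : ℝ≥0∞ :=
  ∫⁻ p, ‖state A π p.1 p.2 n j‖ₑ ^ 2 ∂(ρ.prod noiseLaw)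

lemma stateMoment_eq (hβ : 1 < β) (ρ : Measure (Fin N → ℂ)) [IsProbabilityMeasure ρ]
    (n : ℕ) (j : Fin N) :
    stateMoment (symmetricA N β) (optController N β) ρ (n + 1) j =
      ∫⁻ s, ‖initialResponse β s n j‖ₑ ^ 2 ∂ρ +
        ENNReal.ofReal (∑ m ∈ Finset.range n, impulse N β m ^ 2) := by
  rw [stateMoment, lintegral_prod _
    ((measurable_state measurable_optController (n + 1) j).enorm.pow_const 2).aemeasurable]
  simp only [lintegral_state_sq hβ]
  rw [lintegral_add_right' _ aemeasurable_const]
  simp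

lemma le_stateMoment (hβ : 1 < β) (ρ : Measure (Fin N → ℂ)) [IsProbabilityMeasure ρ]
    (n : ℕ) (j : Fin N) :
    ENNReal.ofReal (∑ m ∈ Finset.range n, impulse N β m ^ 2) ≤
      stateMoment (symmetricA N β) (optController N β) ρ (n + 1) j := by
  rw [stateMoment_eq hβ]
  exact le_add_self

lemma stateMoment_le (hβ : 1 < β) (ρ : Measure (Fin N → ℂ)) [IsProbabilityMeasure ρ]
    (hρ : ∀ᵐ s ∂ρ, ∀ k, ‖s k‖ ≤ 2) (n : ℕ) (j : Fin N) :
    stateMoment (symmetricA N β) (optController N β) ρ (n + 1) j ≤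
      ENNReal.ofReal (transient N β n ^ 2 + ∑ m ∈ Finset.range n, impulse N β m ^ 2) := by
  rw [stateMoment_eq hβ, ENNReal.ofReal_add (sq_nonneg _)
    (Finset.sum_nonneg fun _ _ => sq_nonneg _)]
  gcongr
  calc ∫⁻ s, ‖initialResponse β s n j‖ₑ ^ 2 ∂ρ
      ≤ ∫⁻ _, ENNReal.ofReal (transient N β n ^ 2) ∂ρ := by
        refine lintegral_mono_ae (hρ.mono fun s hs => ?_)
        rw [enorm_sq_eq_ofReal]
        exact ENNReal.ofReal_le_ofReal
          (pow_le_pow_left₀ (norm_nonneg _) (norm_initialResponse_le hβ hs n j) 2)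
    _ = _ := by simp

/-- The noise contributes the partial energy of the impulse response, and the initial state at most
the square of the vanishing transient. -/
lemma tendsto_stateMoment (hN : 1 ≤ N) (hβ : 1 < β) (ρ : Measure (Fin N → ℂ))
    [IsProbabilityMeasure ρ] (hρ : ∀ᵐ s ∂ρ, ∀ k, ‖s k‖ ≤ 2) (j : Fin N) :
    Tendsto (fun n => stateMoment (symmetricA N β) (optController N β) ρ n j) atTop
      (𝓝 (ENNReal.ofReal (stationaryMoment N β))) := by
  refine (tendsto_add_atTop_iff_nat 1).1 ?_
  refine tendsto_of_tendsto_of_tendsto_of_le_of_le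
    (ENNReal.tendsto_ofReal (tendsto_sum_impulse_sq hN hβ)) ?_
    (fun n => le_stateMoment hβ ρ n j) (fun n => stateMoment_le hβ ρ hρ n j)
  refine ENNReal.tendsto_ofReal ?_
  simpa using ((tendsto_transient hN hβ).pow 2).add (tendsto_sum_impulse_sq hN hβ)

lemma userPower_eq (hβ : 1 < β) (ρ : Measure (Fin N → ℂ)) (j : Fin N) (i : ℕ) :
    userPower (symmetricA N β) (optController N β) ρ j i =
      ENNReal.ofReal (gainModulus N β ^ 2) *
        stateMoment (symmetricA N β) (optController N β) ρ i j := by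
  rw [userPower, stateMoment, ← lintegral_const_mul' _ _ ENNReal.ofReal_ne_top]
  refine lintegral_congr fun p => ?_
  rw [userInput, optController_apply hβ, enorm_neg, enorm_mul, mul_pow, enorm_sq_eq_ofReal,
    norm_mul, norm_root, mul_one, Complex.norm_real, Real.norm_eq_abs, sq_abs]

lemma gainModulus_sq_mul_stationaryMoment (hN : 1 ≤ N) (hβ : 1 < β) :
    gainModulus N β ^ 2 * stationaryMoment N β = senderPower N (β ^ 2) := by
  have hb := one_lt_sq hβ
  have hN' : (N : ℝ) ≠ 0 := by exact_mod_cast (by omega : N ≠ 0)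
  have h1 : β ^ 2 - 1 ≠ 0 := by linarith
  symm
  rw [senderPower_eq_iff hN (by linarith), geom_sum_eq hb.ne', gainModulus, stationaryMoment,
    pow_mul]
  have hpow : (β ^ 2) ^ N = β ^ 2 * (β ^ 2) ^ (N - 1) := by
    rw [← pow_succ', Nat.sub_add_cancel hN]
  have hm : (β ^ 2) ^ (N - 1) ≠ 0 := by positivity
  rw [hpow]
  generalize (β ^ 2) ^ (N - 1) = m at hm
  have hβ0 : β ≠ 0 := by linarith
  field_simp

end ClosedLoop

/-! ### Boundedness of the uniform messages. -/

section Messages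

lemma norm_le_two_of_mem_unitSquare {z : ℂ} (hz : z ∈ unitSquare) : ‖z‖ ≤ 2 := by
  obtain ⟨h1, h2⟩ := hz
  refine (Complex.norm_le_abs_re_add_abs_im z).trans ?_
  rw [abs_of_pos h1.1, abs_of_pos h2.1]
  linarith [h1.2, h2.2]

lemma isOpen_unitSquare : IsOpen unitSquare := isOpen_Ioo.reProdIm isOpen_Ioo

instance : IsProbabilityMeasure (ProbabilityTheory.cond (volume : Measure ℂ) unitSquare) := by
  refine cond_isProbabilityMeasure_of_finite ?_ ?_
  · refine (isOpen_unitSquare.measure_pos volume ⟨⟨1 / 2, 1 / 2⟩, ?_, ?_⟩).ne' <;>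
      norm_num
  · refine (Bornology.IsBounded.measure_lt_top ?_).ne
    exact (isBounded_iff_forall_norm_le.2 ⟨2, fun z hz => norm_le_two_of_mem_unitSquare hz⟩)

instance (N : ℕ) : IsProbabilityMeasure (uniformMessageLaw N) := by
  unfold uniformMessageLaw; infer_instance

lemma ae_uniformMessageLaw_norm_le (N : ℕ) : ∀ᵐ s ∂uniformMessageLaw N, ∀ k, ‖s k‖ ≤ 2 := by
  refine ae_all_iff.2 fun k => ?_
  have h : ∀ᵐ z ∂ProbabilityTheory.cond (volume : Measure ℂ) unitSquare, ‖z‖ ≤ 2 :=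
    (ae_cond_mem isOpen_unitSquare.measurableSet).mono fun z hz => norm_le_two_of_mem_unitSquare hz
  exact (Measure.tendsto_eval_ae_ae (μ := fun _ : Fin N =>
    ProbabilityTheory.cond (volume : Measure ℂ) unitSquare) (i := k)).eventually h

end Messages

/-! ### Dynamic programming against arbitrary separated stabilizing controllers. -/

section Optimality

variable {N : ℕ} {β : ℝ}

/-- Causality: the sample `z i` first enters the state at time `i + 1`, so it is independent of
state and inputs at time `i`. -/
lemma state_update (π : Controller N) (s₀ : Fin N → ℂ) (z : ℕ → ℂ) (i : ℕ) (w : ℂ) {n : ℕ}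
    (hn : n ≤ i) : state (symmetricA N β) π s₀ (Function.update z i w) n =
      state (symmetricA N β) π s₀ z n := by
  induction n with
  | zero => rfl
  | succ n ih =>
    have := ih (by omega)
    simp only [state, this, Function.update_of_ne (by omega : n ≠ i)]

/-- The scaled Fourier coordinates of the state. -/
noncomputable def mode (β : ℝ) (r : ℕ) (s : Fin N → ℂ) : ℂ :=
  (β : ℂ) ^ r * ∑ k, root N k ^ r * s k

lemma measurable_mode (r : ℕ) : Measurable (mode β r : (Fin N → ℂ) → ℂ) := by
  unfold mode; fun_prop

/-- In Fourier coordinates the system is a shift register; the input is multiplied by `∑ ω_k^r`, so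
it reaches only the indices divisible by `N`. -/
lemma mode_next (r : ℕ) (s : Fin N → ℂ) (y : ℂ) :
    mode β r (fun j => β * root N j * s j + y) =
      mode β (r + 1) s + if N ∣ r then (β : ℂ) ^ r * N * y else 0 := by
  have h := sum_root_pow (N := N) r
  have h2 : ∑ k, root N k ^ r * (β * root N k * s k + y) =
      β * ∑ k, root N k ^ (r + 1) * s k + (∑ k, root N k ^ r) * y := by
    rw [Finset.mul_sum, Finset.sum_mul, ← Finset.sum_add_distrib]
    exact Finset.sum_congr rfl fun k _ => by ring
  rw [mode, mode, h2, h]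
  split_ifs <;> ring

/-- The value function `s'Gs`. -/
noncomputable def valueFunction (β : ℝ) (s : Fin N → ℂ) : ℝ≥0∞ :=
  ENNReal.ofReal ((1 - (β ^ (2 * N))⁻¹) / (N : ℝ) ^ 2) *
    ∑ r ∈ Finset.range N, ‖mode β (r + 1) s‖ₑ ^ 2

lemma measurable_valueFunction : Measurable (valueFunction β : (Fin N → ℂ) → ℝ≥0∞) := by
  unfold valueFunction
  exact (Finset.measurable_fun_sum _ fun r _ =>
    (measurable_mode (r + 1)).enorm.pow_const 2).const_mul _

/-- The component of the state which the controller has to act on. -/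
noncomputable def leadMode (β : ℝ) (s : Fin N → ℂ) : ℂ := mode β 1 s / N

lemma measurable_leadMode : Measurable (leadMode β : (Fin N → ℂ) → ℂ) :=
  (measurable_mode 1).div_const _

/-- The value is a sum over modes `1, …, N`. After a step, modes `1, …, N-1` are the old modes `2,
…, N`; the old mode `1` leaves, and the new mode `N` is `β^N N` times `leadMode β s + y`. The
leaving term stands on the left to avoid subtraction in `[0, ∞]`. -/
lemma valueFunction_next (hN : 1 ≤ N) (hβ : 1 < β) (s : Fin N → ℂ) (y : ℂ) :
    valueFunction β (fun j => β * root N j * s j + y) +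
        ENNReal.ofReal (1 - (β ^ (2 * N))⁻¹) * ‖leadMode β s‖ₑ ^ 2 =
      valueFunction β s + ENNReal.ofReal (β ^ (2 * N) - 1) * ‖leadMode β s + y‖ₑ ^ 2 := by
  have hδ := one_sub_inv_pow_pos (N := N) hβ (by omega)
  have hN' : (0 : ℝ) < N := by exact_mod_cast hN
  have hNc : (N : ℂ) ≠ 0 := by exact_mod_cast hN'.ne'
  have hβ0 : β ≠ 0 := by linarith
  set c := (1 - (β ^ (2 * N))⁻¹) / (N : ℝ) ^ 2 with hc
  have hc0 : 0 ≤ c := by positivity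
  have hlead : ENNReal.ofReal (1 - (β ^ (2 * N))⁻¹) * ‖leadMode β s‖ₑ ^ 2 =
      ENNReal.ofReal c * ‖mode β 1 s‖ₑ ^ 2 := by
    rw [enorm_sq_eq_ofReal, enorm_sq_eq_ofReal, ← ENNReal.ofReal_mul hδ.le,
      ← ENNReal.ofReal_mul hc0, leadMode, norm_div, Complex.norm_natCast, div_pow, hc]
    congr 1
    field_simp
  have hlast : ENNReal.ofReal (β ^ (2 * N) - 1) * ‖leadMode β s + y‖ₑ ^ 2 =
      ENNReal.ofReal c * ‖mode β N (fun j => β * root N j * s j + y)‖ₑ ^ 2 := by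
    have h1 : mode β N (fun j => β * root N j * s j + y) =
        ((β ^ N * N : ℝ) : ℂ) * (leadMode β s + y) := by
      have h2 : mode β (N + 1) s = (β : ℂ) ^ N * mode β 1 s := by
        simp only [mode, pow_succ, root_pow_card]
        ring_nf
      rw [mode_next, if_pos dvd_rfl, h2, leadMode]
      push_cast
      field_simp
    have hw : 0 ≤ β ^ (2 * N) - 1 := by linarith [one_le_pow₀ hβ.le (n := 2 * N)]
    rw [h1, enorm_sq_eq_ofReal, enorm_sq_eq_ofReal, ← ENNReal.ofReal_mul hw,
      ← ENNReal.ofReal_mul hc0, norm_mul, Complex.norm_real, mul_pow, Real.norm_eq_abs, sq_abs, hc]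
    congr 1
    rw [pow_mul, pow_right_comm β 2 N]
    field_simp
  rw [hlead, hlast, valueFunction, valueFunction, ← mul_add, ← mul_add]
  congr 1
  obtain ⟨M, rfl⟩ : ∃ M, N = M + 1 := ⟨N - 1, by omega⟩
  rw [Finset.sum_range_succ, Finset.sum_range_succ' (fun r => ‖mode β (r + 1) s‖ₑ ^ 2), zero_add]
  have h : ∀ r ∈ Finset.range M, mode β (r + 1) (fun j => β * root (M + 1) j * s j + y) =
      mode β (r + 1 + 1) s := by
    intro r hr
    rw [mode_next, if_neg, add_zero]
    intro hd
    have := Nat.le_of_dvd (by omega) hd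
    have := Finset.mem_range.1 hr
    omega
  rw [Finset.sum_congr rfl fun r hr => by rw [h r hr]]
  abel

lemma valueFunction_le (hβ : 1 < β) (s : Fin N → ℂ) :
    valueFunction β s ≤ ENNReal.ofReal ((1 - (β ^ (2 * N))⁻¹) / (N : ℝ) ^ 2) *
      ((∑ r ∈ Finset.range N, ENNReal.ofReal ((β ^ (r + 1)) ^ 2 * N)) * ∑ k, ‖s k‖ₑ ^ 2) := by
  unfold valueFunction
  rw [Finset.sum_mul]
  gcongr with r
  have h1 : ‖∑ k, root N k ^ (r + 1) * s k‖ ≤ ∑ k, ‖s k‖ := by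
    refine (norm_sum_le _ _).trans (le_of_eq (Finset.sum_congr rfl fun k _ => ?_))
    rw [norm_mul, norm_pow, norm_root, one_pow, one_mul]
  have h2 : (∑ k, ‖s k‖) ^ 2 ≤ N * ∑ k, ‖s k‖ ^ 2 := by
    simpa using sq_sum_le_card_mul_sum_sq (s := Finset.univ) (f := fun k => ‖s k‖)
  have h3 : ∑ k, ‖s k‖ₑ ^ 2 = ENNReal.ofReal (∑ k, ‖s k‖ ^ 2) := by
    rw [ENNReal.ofReal_sum_of_nonneg fun _ _ => sq_nonneg _]
    exact Finset.sum_congr rfl fun k _ => enorm_sq_eq_ofReal _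
  rw [h3, ← ENNReal.ofReal_mul (by positivity), enorm_sq_eq_ofReal]
  refine ENNReal.ofReal_le_ofReal ?_
  rw [mode, norm_mul, norm_pow, Complex.norm_real, Real.norm_of_nonneg (by linarith), mul_pow,
    mul_assoc]
  gcongr
  exact (pow_le_pow_left₀ (norm_nonneg _) h1 2).trans h2

lemma leadMode_le_valueFunction (hN : 1 ≤ N) (hβ : 1 < β) (s : Fin N → ℂ) :
    ENNReal.ofReal (1 - (β ^ (2 * N))⁻¹) * ‖leadMode β s‖ₑ ^ 2 ≤ valueFunction β s := by
  have hδ := one_sub_inv_pow_pos (N := N) hβ (by omega)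
  have hN' : (0 : ℝ) < N := by exact_mod_cast hN
  have hlead : ENNReal.ofReal (1 - (β ^ (2 * N))⁻¹) * ‖leadMode β s‖ₑ ^ 2 =
      ENNReal.ofReal ((1 - (β ^ (2 * N))⁻¹) / (N : ℝ) ^ 2) * ‖mode β 1 s‖ₑ ^ 2 := by
    rw [enorm_sq_eq_ofReal, enorm_sq_eq_ofReal, ← ENNReal.ofReal_mul hδ.le,
      ← ENNReal.ofReal_mul (by positivity), leadMode, norm_div, Complex.norm_natCast, div_pow]
    congr 1
    field_simp
  rw [hlead, valueFunction]
  gcongr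
  exact Finset.single_le_sum (f := fun r => ‖mode β (r + 1) s‖ₑ ^ 2) (fun _ _ => zero_le)
    (Finset.mem_range.2 hN)

/-- The combined signal `∑_j X_{ji}`. -/
noncomputable def controlInput (β : ℝ) (π : Controller N) (i : ℕ)
    (p : (Fin N → ℂ) × (ℕ → ℂ)) : ℂ :=
  ∑ j, userInput (symmetricA N β) π p.1 p.2 j i

/-- The expected value function. -/
noncomputable def expectedValue (β : ℝ) (π : Controller N) (ρ : Measure (Fin N → ℂ)) (i : ℕ) :
    ℝ≥0∞ :=
  ∫⁻ p, valueFunction β (state (symmetricA N β) π p.1 p.2 i) ∂(ρ.prod noiseLaw)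

/-- `E |∑_j X_{ji}|²`. -/
noncomputable def controlPower (β : ℝ) (π : Controller N) (ρ : Measure (Fin N → ℂ)) (i : ℕ) :
    ℝ≥0∞ :=
  ∫⁻ p, ‖controlInput β π i p‖ₑ ^ 2 ∂(ρ.prod noiseLaw)

variable {π : Controller N} {ρ : Measure (Fin N → ℂ)}

lemma measurable_state' (hπ : ∀ j i, Measurable (π j i)) (i : ℕ) :
    Measurable fun p : (Fin N → ℂ) × (ℕ → ℂ) => state (symmetricA N β) π p.1 p.2 i :=
  measurable_pi_lambda _ fun j => measurable_state hπ i j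

lemma measurable_controlInput (hπ : ∀ j i, Measurable (π j i)) (i : ℕ) :
    Measurable (controlInput β π i) :=
  Finset.measurable_fun_sum _ fun j _ => (hπ j i).comp (measurable_state hπ i j)

lemma state_succ' (π : Controller N) (p : (Fin N → ℂ) × (ℕ → ℂ)) {i : ℕ} (hi : i ≠ 0) :
    state (symmetricA N β) π p.1 p.2 (i + 1) =
      fun j => β * root N j * state (symmetricA N β) π p.1 p.2 i j +
        (controlInput β π i p + p.2 i) := by
  ext j
  rw [state_succ, output, outputOf, if_neg hi]
  rfl

lemma lintegral_add_innovation [IsProbabilityMeasure ρ]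
    {f : (Fin N → ℂ) × (ℕ → ℂ) → ℂ} (hf : Measurable f) (i : ℕ)
    (hfi : ∀ s z w, f (s, Function.update z i w) = f (s, z)) :
    ∫⁻ p, ‖f p + p.2 i‖ₑ ^ 2 ∂(ρ.prod noiseLaw) = ∫⁻ p, ‖f p‖ₑ ^ 2 ∂(ρ.prod noiseLaw) + 1 := by
  rw [lintegral_prod _ (by fun_prop), lintegral_prod _ (by fun_prop)]
  simp only
  have h : ∀ s, ∫⁻ z, ‖f (s, z) + z i‖ₑ ^ 2 ∂noiseLaw = ∫⁻ z, ‖f (s, z)‖ₑ ^ 2 ∂noiseLaw + 1 :=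
    fun s => lintegral_add_noise (f := fun z => f (s, z)) (by fun_prop) i (hfi s)
  simp only [h]
  rw [lintegral_add_right' _ aemeasurable_const]
  simp

/-- Averaging `valueFunction_next` with `y` the input plus noise: the independent noise adds exactly
`β^(2N) - 1`. -/
lemma expectedValue_succ [IsProbabilityMeasure ρ] (hN : 1 ≤ N) (hβ : 1 < β)
    (hπ : ∀ j i, Measurable (π j i)) {i : ℕ} (hi : i ≠ 0) :
    expectedValue β π ρ (i + 1) + ∫⁻ p, ENNReal.ofReal (1 - (β ^ (2 * N))⁻¹) *
        ‖leadMode β (state (symmetricA N β) π p.1 p.2 i)‖ₑ ^ 2 ∂(ρ.prod noiseLaw) =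
      expectedValue β π ρ i + (∫⁻ p, ENNReal.ofReal (β ^ (2 * N) - 1) *
        ‖leadMode β (state (symmetricA N β) π p.1 p.2 i) + controlInput β π i p‖ₑ ^ 2
          ∂(ρ.prod noiseLaw) + ENNReal.ofReal (β ^ (2 * N) - 1)) := by
  have hs := measurable_state' (β := β) hπ i
  have hs1 := measurable_state' (β := β) hπ (i + 1)
  have hv : Measurable fun p : (Fin N → ℂ) × (ℕ → ℂ) =>
      valueFunction β (state (symmetricA N β) π p.1 p.2 i) := measurable_valueFunction.comp hs
  have hv1 : Measurable fun p : (Fin N → ℂ) × (ℕ → ℂ) =>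
      valueFunction β (state (symmetricA N β) π p.1 p.2 (i + 1)) := measurable_valueFunction.comp hs1
  have hl : Measurable fun p : (Fin N → ℂ) × (ℕ → ℂ) =>
      leadMode β (state (symmetricA N β) π p.1 p.2 i) := measurable_leadMode.comp hs
  have hc := measurable_controlInput (β := β) hπ i
  have hinn := lintegral_add_innovation (ρ := ρ) (hl.add hc) i (fun s z w => by
    simp only [Pi.add_apply, controlInput, userInput, state_update π s z i w le_rfl])
  simp only [Pi.add_apply] at hinn
  rw [expectedValue, expectedValue, ← lintegral_add_left hv1,
    lintegral_const_mul' _ _ ENNReal.ofReal_ne_top, ← mul_add_one, ← hinn,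
    ← lintegral_const_mul' _ _ ENNReal.ofReal_ne_top,
    ← lintegral_add_left hv]
  refine lintegral_congr fun p => ?_
  rw [state_succ' π p hi, valueFunction_next hN hβ, add_assoc]

lemma quadratic_lower_bound {w : ℝ} (hw : 0 ≤ w) (u x : ℂ) :
    ENNReal.ofReal (1 - (w + 1)⁻¹) * ‖u‖ₑ ^ 2 ≤ ‖x‖ₑ ^ 2 + ENNReal.ofReal w * ‖u + x‖ₑ ^ 2 := by
  have h0 : (w + 1)⁻¹ ≤ 1 := inv_le_one_of_one_le₀ (by linarith)
  rw [enorm_sq_eq_ofReal, enorm_sq_eq_ofReal, enorm_sq_eq_ofReal,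
    ← ENNReal.ofReal_mul (by linarith), ← ENNReal.ofReal_mul hw,
    ← ENNReal.ofReal_add (by positivity) (by positivity)]
  refine ENNReal.ofReal_le_ofReal ?_
  have key : ∀ a b : ℝ, (1 - (w + 1)⁻¹) * a ^ 2 ≤ b ^ 2 + w * (a + b) ^ 2 := fun a b => by
    -- Completing the square in `b`; the minimizer `-(1 - (w + 1)⁻¹) a` is the one used in
    -- `quadratic_attained`.
    have h : b ^ 2 + w * (a + b) ^ 2 - (1 - (w + 1)⁻¹) * a ^ 2 =
        (w + 1) * (b + (1 - (w + 1)⁻¹) * a) ^ 2 := by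
      field_simp
      ring
    have : 0 ≤ (w + 1) * (b + (1 - (w + 1)⁻¹) * a) ^ 2 := by positivity
    linarith
  simp only [Complex.sq_norm, Complex.normSq_apply, Complex.add_re, Complex.add_im]
  linarith [key u.re x.re, key u.im x.im]

lemma quadratic_attained {w : ℝ} (hw : 0 ≤ w) (u : ℂ) :
    ‖-(((1 - (w + 1)⁻¹ : ℝ) : ℂ) * u)‖ₑ ^ 2 +
        ENNReal.ofReal w * ‖u + -(((1 - (w + 1)⁻¹ : ℝ) : ℂ) * u)‖ₑ ^ 2 =
      ENNReal.ofReal (1 - (w + 1)⁻¹) * ‖u‖ₑ ^ 2 := by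
  have h0 : (w + 1)⁻¹ ≤ 1 := inv_le_one_of_one_le₀ (by linarith)
  rw [enorm_sq_eq_ofReal, enorm_sq_eq_ofReal, enorm_sq_eq_ofReal,
    ← ENNReal.ofReal_mul hw, ← ENNReal.ofReal_mul (by linarith : 0 ≤ 1 - (w + 1)⁻¹),
    ← ENNReal.ofReal_add (by positivity) (by positivity)]
  congr 1
  have h1 : u + -(((1 - (w + 1)⁻¹ : ℝ) : ℂ) * u) = (((w + 1)⁻¹ : ℝ) : ℂ) * u := by
    push_cast; ring
  rw [h1, norm_neg, norm_mul, norm_mul, Complex.norm_real, Complex.norm_real, mul_pow, mul_pow,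
    Real.norm_eq_abs, Real.norm_eq_abs, sq_abs, sq_abs]
  field_simp
  ring

lemma expectedValue_lead_ne_top (hN : 1 ≤ N) (hβ : 1 < β) {i : ℕ}
    (hfin : expectedValue β π ρ i ≠ ∞) :
    ∫⁻ p, ENNReal.ofReal (1 - (β ^ (2 * N))⁻¹) *
      ‖leadMode β (state (symmetricA N β) π p.1 p.2 i)‖ₑ ^ 2 ∂(ρ.prod noiseLaw) ≠ ∞ :=
  ne_top_of_le_ne_top hfin (lintegral_mono fun _ => leadMode_le_valueFunction hN hβ _)

/-- The quadratic bound with `w + 1 = β^(2N)` is applied pointwise to the input. Finiteness of the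
value is what allows the lead-mode term to be cancelled in `[0, ∞]`. -/
lemma expectedValue_add_le [IsProbabilityMeasure ρ] (hN : 1 ≤ N) (hβ : 1 < β)
    (hπ : ∀ j i, Measurable (π j i)) {i : ℕ} (hi : i ≠ 0)
    (hfin : expectedValue β π ρ i ≠ ∞) :
    expectedValue β π ρ i + ENNReal.ofReal (β ^ (2 * N) - 1) ≤
      expectedValue β π ρ (i + 1) + controlPower β π ρ i := by
  have hw : 0 ≤ β ^ (2 * N) - 1 := by linarith [one_le_pow₀ hβ.le (n := 2 * N)]
  have hc := measurable_controlInput (β := β) hπ i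
  refine (ENNReal.add_le_add_iff_right (expectedValue_lead_ne_top hN hβ hfin)).1 ?_
  rw [add_right_comm (expectedValue β π ρ (i + 1)), expectedValue_succ hN hβ hπ hi]
  have h : ∫⁻ p, ENNReal.ofReal (1 - (β ^ (2 * N))⁻¹) *
      ‖leadMode β (state (symmetricA N β) π p.1 p.2 i)‖ₑ ^ 2 ∂(ρ.prod noiseLaw) ≤
      controlPower β π ρ i + ∫⁻ p, ENNReal.ofReal (β ^ (2 * N) - 1) *
        ‖leadMode β (state (symmetricA N β) π p.1 p.2 i) + controlInput β π i p‖ₑ ^ 2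
          ∂(ρ.prod noiseLaw) := by
    rw [controlPower, ← lintegral_add_left (hc.enorm.pow_const 2)]
    refine lintegral_mono fun p => ?_
    simpa only [sub_add_cancel] using quadratic_lower_bound hw
      (leadMode β (state (symmetricA N β) π p.1 p.2 i)) (controlInput β π i p)
  calc _ ≤ expectedValue β π ρ i + ENNReal.ofReal (β ^ (2 * N) - 1) + _ := add_le_add_right h _
    _ = _ := by abel

/-- The Riccati gain is exactly the pointwise minimizer in the completed square, so the lower bound
is attained at every step. -/
lemma controlInput_optController (hβ : 1 < β) (i : ℕ) (p : (Fin N → ℂ) × (ℕ → ℂ)) :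
    controlInput β (optController N β) i p = -(((1 - (β ^ (2 * N))⁻¹ : ℝ) : ℂ) *
      leadMode β (state (symmetricA N β) (optController N β) p.1 p.2 i)) := by
  simp only [controlInput, userInput, optController_apply hβ, Finset.sum_neg_distrib, leadMode,
    mode, gainModulus, pow_one, mul_assoc, ← Finset.mul_sum]
  push_cast
  ring

lemma expectedValue_add_eq [IsProbabilityMeasure ρ] (hN : 1 ≤ N) (hβ : 1 < β)
    {i : ℕ} (hi : i ≠ 0) (hfin : expectedValue β (optController N β) ρ i ≠ ∞) :
    expectedValue β (optController N β) ρ (i + 1) + controlPower β (optController N β) ρ i =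
      expectedValue β (optController N β) ρ i + ENNReal.ofReal (β ^ (2 * N) - 1) := by
  have hπ : ∀ j i, Measurable (optController N β j i) := measurable_optController
  have hw : 0 ≤ β ^ (2 * N) - 1 := by linarith [one_le_pow₀ hβ.le (n := 2 * N)]
  have hc := measurable_controlInput (β := β) hπ i
  refine (ENNReal.add_left_inj (expectedValue_lead_ne_top hN hβ hfin)).1 ?_
  rw [add_right_comm (expectedValue β (optController N β) ρ (i + 1)),
    expectedValue_succ hN hβ hπ hi]
  have h : controlPower β (optController N β) ρ i + ∫⁻ p, ENNReal.ofReal (β ^ (2 * N) - 1) *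
        ‖leadMode β (state (symmetricA N β) (optController N β) p.1 p.2 i) +
          controlInput β (optController N β) i p‖ₑ ^ 2 ∂(ρ.prod noiseLaw) =
      ∫⁻ p, ENNReal.ofReal (1 - (β ^ (2 * N))⁻¹) *
      ‖leadMode β (state (symmetricA N β) (optController N β) p.1 p.2 i)‖ₑ ^ 2
        ∂(ρ.prod noiseLaw) := by
    rw [controlPower, ← lintegral_add_left (hc.enorm.pow_const 2)]
    refine lintegral_congr fun p => ?_
    rw [controlInput_optController hβ]
    simpa only [sub_add_cancel] using quadratic_attained hw
      (leadMode β (state (symmetricA N β) (optController N β) p.1 p.2 i))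
  rw [← h]
  abel

lemma expectedValue_le (hβ : 1 < β) (hπ : ∀ j i, Measurable (π j i)) (i : ℕ) :
    expectedValue β π ρ i ≤ ENNReal.ofReal ((1 - (β ^ (2 * N))⁻¹) / (N : ℝ) ^ 2) *
      ((∑ r ∈ Finset.range N, ENNReal.ofReal ((β ^ (r + 1)) ^ 2 * N)) *
        ∑ k, stateMoment (symmetricA N β) π ρ i k) := by
  have hK : ∑ r ∈ Finset.range N, ENNReal.ofReal ((β ^ (r + 1)) ^ 2 * N) ≠ ∞ := by
    simp [ENNReal.sum_eq_top]
  refine (lintegral_mono fun p => valueFunction_le hβ _).trans_eq ?_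
  rw [lintegral_const_mul' _ _ ENNReal.ofReal_ne_top, lintegral_const_mul' _ _ hK,
    lintegral_finsetSum _ fun k _ => (measurable_state hπ i k).enorm.pow_const 2]
  rfl

lemma expectedValue_telescope_le [IsProbabilityMeasure ρ] (hN : 1 ≤ N) (hβ : 1 < β)
    (hπ : ∀ j i, Measurable (π j i)) {n₀ : ℕ} (h0 : n₀ ≠ 0)
    (hfin : ∀ i, n₀ ≤ i → expectedValue β π ρ i ≠ ∞) (m : ℕ) :
    m * ENNReal.ofReal (β ^ (2 * N) - 1) ≤
      expectedValue β π ρ (n₀ + m) + ∑ i ∈ Finset.Ico n₀ (n₀ + m), controlPower β π ρ i := by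
  induction m with
  | zero => simp
  | succ m ih =>
    rw [← add_assoc, Finset.sum_Ico_succ_top (by omega), Nat.cast_succ, add_one_mul]
    calc _ ≤ expectedValue β π ρ (n₀ + m) + ∑ i ∈ Finset.Ico n₀ (n₀ + m), controlPower β π ρ i +
          ENNReal.ofReal (β ^ (2 * N) - 1) := by gcongr
      _ = expectedValue β π ρ (n₀ + m) + ENNReal.ofReal (β ^ (2 * N) - 1) +
          ∑ i ∈ Finset.Ico n₀ (n₀ + m), controlPower β π ρ i := by abel
      _ ≤ expectedValue β π ρ (n₀ + m + 1) + controlPower β π ρ (n₀ + m) +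
          ∑ i ∈ Finset.Ico n₀ (n₀ + m), controlPower β π ρ i :=
          add_le_add_left (expectedValue_add_le hN hβ hπ (by omega) (hfin _ (by omega))) _
      _ = _ := by abel

lemma expectedValue_telescope_eq [IsProbabilityMeasure ρ] (hN : 1 ≤ N) (hβ : 1 < β)
    (hfin : ∀ i, 1 ≤ i → expectedValue β (optController N β) ρ i ≠ ∞) (m : ℕ) :
    expectedValue β (optController N β) ρ (m + 1) +
        ∑ i ∈ Finset.Icc 1 m, controlPower β (optController N β) ρ i =
      expectedValue β (optController N β) ρ 1 + m * ENNReal.ofReal (β ^ (2 * N) - 1) := by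
  induction m with
  | zero => simp
  | succ m ih =>
    rw [Finset.sum_Icc_succ_top (by omega), Nat.cast_succ, add_one_mul, ← add_assoc, ← add_assoc, ← ih,
      add_right_comm, expectedValue_add_eq hN hβ m.succ_ne_zero (hfin _ (by omega)),
      add_right_comm]

/-- Stabilization bounds the expected value by some `M` only from a time `n₀` on, so the telescoping
starts there; `n₀` and `M` cost `(n₀ w + M)/n`, which vanishes. -/
lemma liminf_averageControlPower_ge (hN : 1 ≤ N) (hβ : 1 < β)
    (hπ : ∀ j i, Measurable (π j i)) (hst : Stabilizes (symmetricA N β) π) :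
    ENNReal.ofReal (β ^ (2 * N) - 1) ≤
      liminf (averageControlPower (symmetricA N β) π) atTop := by
  set w := β ^ (2 * N) - 1 with hwdef
  have hw : 0 ≤ w := by linarith [one_le_pow₀ hβ.le (n := 2 * N)]
  have hbound : ∃ M : ℝ, 0 ≤ M ∧ ∃ n₀, n₀ ≠ 0 ∧ ∀ i, n₀ ≤ i →
      expectedValue β π (uniformMessageLaw N) i ≤ ENNReal.ofReal M := by
    have h1 : ∀ j, ∃ c : ℝ≥0∞, c < ∞ ∧ ∀ᶠ n in atTop,
        stateMoment (symmetricA N β) π (uniformMessageLaw N) n j < c := fun j => by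
      obtain ⟨c, hc1, hc2⟩ := exists_between (hst j)
      exact ⟨c, hc2, eventually_lt_of_limsup_lt hc1⟩
    choose c hc1 hc2 using h1
    obtain ⟨n₀, hn₀⟩ := eventually_atTop.1 (eventually_all.2 hc2)
    obtain ⟨C, hC⟩ : ∃ C, C = ENNReal.ofReal ((1 - (β ^ (2 * N))⁻¹) / (N : ℝ) ^ 2) *
      ((∑ r ∈ Finset.range N, ENNReal.ofReal ((β ^ (r + 1)) ^ 2 * N)) * ∑ k, c k) := ⟨_, rfl⟩
    have hK : C ≠ ∞ := by
      rw [hC]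
      refine ENNReal.mul_ne_top ENNReal.ofReal_ne_top (ENNReal.mul_ne_top ?_ ?_)
      · simp [ENNReal.sum_eq_top]
      · exact ENNReal.sum_ne_top.2 fun k _ => (hc1 k).ne
    refine ⟨C.toReal, ENNReal.toReal_nonneg, n₀ + 1, by omega, fun i hi => ?_⟩
    rw [ENNReal.ofReal_toReal hK, hC]
    refine (expectedValue_le hβ hπ i).trans ?_
    gcongr with k
    exact (hn₀ i (by omega) k).le
  obtain ⟨M, hM0, n₀, hn₀, hM⟩ := hbound
  have hlim : Tendsto (fun n : ℕ => ENNReal.ofReal (w - (n₀ * w + M) / n)) atTop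
      (𝓝 (ENNReal.ofReal w)) := by
    refine ENNReal.tendsto_ofReal ?_
    simpa using tendsto_const_nhds.sub (tendsto_const_div_atTop_nhds_zero_nat (n₀ * w + M))
  rw [← hlim.liminf_eq]
  refine liminf_le_liminf ?_
  filter_upwards [eventually_ge_atTop n₀] with n hn
  have hn0 : n ≠ 0 := by omega
  have hnpos : (0 : ℝ) < n := by positivity
  have htel := expectedValue_telescope_le (ρ := uniformMessageLaw N) hN hβ hπ hn₀
    (fun i hi => ne_top_of_le_ne_top ENNReal.ofReal_ne_top (hM i hi)) (n - n₀)
  rw [Nat.add_sub_cancel' hn] at htel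
  rw [averageControlPower, ENNReal.le_div_iff_mul_le (by simp [hn0]) (by simp),
    ← ENNReal.ofReal_natCast, ← ENNReal.ofReal_mul' hnpos.le]
  have h2 : (w - (n₀ * w + M) / n) * n = ((n - n₀ : ℕ) : ℝ) * w - M := by
    rw [Nat.cast_sub hn]
    field_simp
    ring
  rw [h2, ENNReal.ofReal_sub _ hM0, tsub_le_iff_left, ENNReal.ofReal_mul (by positivity),
    ENNReal.ofReal_natCast]
  refine htel.trans (add_le_add (hM n hn) ?_)
  refine Finset.sum_le_sum_of_subset fun i hi => ?_
  have := Finset.mem_Ico.1 hi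
  exact Finset.mem_Icc.2 (by omega)

lemma stateMoment_le_const (hN : 1 ≤ N) (hβ : 1 < β) [IsProbabilityMeasure ρ]
    (hρ : ∀ᵐ s ∂ρ, ∀ k, ‖s k‖ ≤ 2) (n : ℕ) (j : Fin N) :
    stateMoment (symmetricA N β) (optController N β) ρ (n + 1) j ≤
      ENNReal.ofReal (transient N β n ^ 2 + stationaryMoment N β) :=
  (stateMoment_le hβ ρ hρ n j).trans
    (ENNReal.ofReal_le_ofReal (add_le_add le_rfl (sum_impulse_sq_le hN hβ n)))

lemma limsup_averageControlPower_le (hN : 1 ≤ N) (hβ : 1 < β) :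
    limsup (averageControlPower (symmetricA N β) (optController N β)) atTop ≤
      ENNReal.ofReal (β ^ (2 * N) - 1) := by
  have hw : 0 ≤ β ^ (2 * N) - 1 := by linarith [one_le_pow₀ hβ.le (n := 2 * N)]
  have hfin : ∀ i, 1 ≤ i →
      expectedValue β (optController N β) (uniformMessageLaw N) i ≠ ∞ := by
    intro i hi
    obtain ⟨n, rfl⟩ : ∃ n, i = n + 1 := ⟨i - 1, by omega⟩
    refine ne_top_of_le_ne_top ?_ (expectedValue_le hβ measurable_optController _)
    refine ENNReal.mul_ne_top ENNReal.ofReal_ne_top (ENNReal.mul_ne_top ?_ ?_)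
    · simp [ENNReal.sum_eq_top]
    · exact ENNReal.sum_ne_top.2 fun k _ => ne_top_of_le_ne_top ENNReal.ofReal_ne_top
        (stateMoment_le_const hN hβ (ae_uniformMessageLaw_norm_le N) n k)
  obtain ⟨v, hv⟩ : ∃ v, v =
    (expectedValue β (optController N β) (uniformMessageLaw N) 1).toReal := ⟨_, rfl⟩
  have hv0 : 0 ≤ v := hv ▸ ENNReal.toReal_nonneg
  have hlim : Tendsto (fun n : ℕ => ENNReal.ofReal (v / n + (β ^ (2 * N) - 1))) atTop
      (𝓝 (ENNReal.ofReal (β ^ (2 * N) - 1))) := by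
    refine ENNReal.tendsto_ofReal ?_
    simpa using (tendsto_const_div_atTop_nhds_zero_nat v).add_const (β ^ (2 * N) - 1)
  rw [← hlim.limsup_eq]
  refine limsup_le_limsup ?_
  filter_upwards [eventually_ge_atTop 1] with n hn
  have hnpos : (0 : ℝ) < n := by exact_mod_cast hn
  have htel := expectedValue_telescope_eq (ρ := uniformMessageLaw N) hN hβ hfin n
  rw [averageControlPower]
  refine ENNReal.div_le_of_le_mul ?_
  rw [← ENNReal.ofReal_natCast, ← ENNReal.ofReal_mul (by positivity)]
  have h2 : (v / n + (β ^ (2 * N) - 1)) * n = v + n * (β ^ (2 * N) - 1) := by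
    field_simp
  rw [h2, ENNReal.ofReal_add hv0 (by positivity), ENNReal.ofReal_mul (by positivity),
    ENNReal.ofReal_natCast, hv, ENNReal.ofReal_toReal (hfin 1 le_rfl), ← htel]
  exact le_add_self

lemma isOptimalController_optController (hN : 1 ≤ N) (hβ : 1 < β) :
    IsOptimalController (symmetricA N β) (optController N β) := by
  refine ⟨fun j => ?_, fun π' hπ' hst => (limsup_averageControlPower_le hN hβ).trans
    (liminf_averageControlPower_ge hN hβ hπ' hst)⟩
  have h := tendsto_stateMoment hN hβ (uniformMessageLaw N) (ae_uniformMessageLaw_norm_le N) j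
  exact h.limsup_eq.trans_lt ENNReal.ofReal_lt_top

end Optimality

/-! ### The estimation error as the rescaled state. -/

section Estimation

variable {N : ℕ} {β : ℝ}

/-- State and decoder state are driven by the same outputs, so their difference obeys the
uncontrolled recursion. -/
lemma decoderState_output (A : Matrix (Fin N) (Fin N) ℂ) (π : Controller N) (s₀ : Fin N → ℂ)
    (z : ℕ → ℂ) (n : ℕ) :
    decoderState A (output A π s₀ z) n = state A π s₀ z n - A ^ n *ᵥ s₀ := by
  induction n with
  | zero => simp [decoderState, state]
  | succ n ih =>
    rw [decoderState, ih, state, Matrix.mulVec_sub, Matrix.mulVec_mulVec, ← pow_succ', output]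
    abel

lemma symmetricA_inv (hβ : 1 < β) :
    (symmetricA N β)⁻¹ = Matrix.diagonal fun j => ((β : ℂ) * root N j)⁻¹ := by
  have hβ0 : (β : ℂ) ≠ 0 := by exact_mod_cast (by linarith : β ≠ 0)
  refine Matrix.inv_eq_right_inv ?_
  rw [symmetricA_eq, Matrix.diagonal_mul_diagonal, ← Matrix.diagonal_one]
  congr 1
  ext j
  exact mul_inv_cancel₀ (mul_ne_zero hβ0 (root_ne_zero j))

lemma norm_sub_estimate (hβ : 1 < β) (π : Controller N) (s₀ : Fin N → ℂ) (z : ℕ → ℂ) (n : ℕ)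
    (j : Fin N) :
    ‖s₀ j - estimate (symmetricA N β) n (output (symmetricA N β) π s₀ z) j‖ =
      (β ^ n)⁻¹ * ‖state (symmetricA N β) π s₀ z n j‖ := by
  have hdet := (Matrix.isUnit_iff_isUnit_det _).1 (isUnit_symmetricA (N := N) hβ)
  have hinv : (symmetricA N β)⁻¹ ^ n * symmetricA N β ^ n = 1 := by
    rw [← (Commute.mul_pow · n), Matrix.nonsing_inv_mul _ hdet, one_pow]
    exact (Matrix.nonsing_inv_mul _ hdet).trans (Matrix.mul_nonsing_inv _ hdet).symm
  have h : s₀ - estimate (symmetricA N β) n (output (symmetricA N β) π s₀ z) =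
      (symmetricA N β)⁻¹ ^ n *ᵥ state (symmetricA N β) π s₀ z n := by
    rw [estimate, decoderState_output, Matrix.mulVec_sub, Matrix.mulVec_mulVec, hinv,
      Matrix.one_mulVec]
    abel
  rw [← Pi.sub_apply, h, symmetricA_inv hβ, Matrix.diagonal_pow, Matrix.mulVec_diagonal,
    Pi.pow_apply, norm_mul, norm_pow, norm_inv, norm_mul, norm_root, mul_one, Complex.norm_real,
    Real.norm_of_nonneg (by linarith), inv_pow]

lemma enorm_sub_estimate_sq (hβ : 1 < β) (π : Controller N) (s₀ : Fin N → ℂ) (z : ℕ → ℂ) (n : ℕ)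
    (j : Fin N) :
    ‖s₀ j - estimate (symmetricA N β) n (output (symmetricA N β) π s₀ z) j‖ₑ ^ 2 =
      ENNReal.ofReal ((β ^ n)⁻¹ ^ 2) * ‖state (symmetricA N β) π s₀ z n j‖ₑ ^ 2 := by
  rw [enorm_sq_eq_ofReal, norm_sub_estimate hβ, mul_pow, ENNReal.ofReal_mul (sq_nonneg _),
    enorm_sq_eq_ofReal]

lemma mse_eq (hβ : 1 < β) (π : Controller N) (j : Fin N) (n : ℕ) :
    mse (symmetricA N β) π j n = ENNReal.ofReal ((β ^ n)⁻¹ ^ 2) *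
      stateMoment (symmetricA N β) π (uniformMessageLaw N) n j := by
  rw [mse, stateMoment, ← lintegral_const_mul' _ _ ENNReal.ofReal_ne_top]
  exact lintegral_congr fun p => enorm_sub_estimate_sq hβ π p.1 p.2 n j

/-- The error is `β^(-2n)` times a second moment with a positive finite limit, whose logarithm
divided by `n` disappears. -/
lemma tendsto_mseExponent (hN : 1 ≤ N) (hβ : 1 < β) (j : Fin N) :
    Tendsto (mseExponent (symmetricA N β) (optController N β) j) atTop
      (𝓝 (Real.logb 2 β)) := by
  have hpos := stationaryMoment_pos (N := N) hβ
  have h := (ENNReal.tendsto_toReal ENNReal.ofReal_ne_top).comp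
    (tendsto_stateMoment hN hβ (uniformMessageLaw N) (ae_uniformMessageLaw_norm_le N) j)
  rw [ENNReal.toReal_ofReal hpos.le] at h
  have hlog := h.log hpos.ne'
  have hlim : Tendsto (fun n : ℕ => Real.logb 2 β - 1 / (2 * Real.log 2) *
      (Real.log (stateMoment (symmetricA N β) (optController N β)
        (uniformMessageLaw N) n j).toReal / n)) atTop (𝓝 (Real.logb 2 β)) := by
    simpa using tendsto_const_nhds.sub
      ((hlog.div_atTop tendsto_natCast_atTop_atTop).const_mul (1 / (2 * Real.log 2)))
  refine hlim.congr' ?_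
  filter_upwards [h.eventually (lt_mem_nhds hpos), eventually_ge_atTop 1] with n hn hn1
  have hn0 : (n : ℝ) ≠ 0 := by exact_mod_cast (by omega : n ≠ 0)
  have hlog2 : Real.log 2 ≠ 0 := (Real.log_pos (by norm_num)).ne'
  have hβ0 : β ≠ 0 := by linarith
  simp only [Function.comp_apply] at hn
  rw [mseExponent, mse_eq hβ, ENNReal.toReal_mul, ENNReal.toReal_ofReal (sq_nonneg _), Real.logb,
    Real.logb, Real.log_mul (by positivity) hn.ne', Real.log_pow, Real.log_inv, Real.log_pow]
  push_cast
  field_simp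
  ring

end Estimation

/-! ### Message grids, decoding and achievable rates. -/

section Coding

lemma exists_measurable_decoder {K : ℕ} (hK : 0 < K) (θ : Fin K → ℂ) {δ : ℝ}
    (hsep : ∀ m m', m ≠ m' → 2 * δ ≤ ‖θ m - θ m'‖) :
    ∃ dec : ℂ → Fin K, Measurable dec ∧ ∀ m y, ‖θ m - y‖ < δ → dec y = m := by
  classical
  have huniq : ∀ {m m' y}, ‖θ m - y‖ < δ → ‖θ m' - y‖ < δ → m = m' := by
    intro m m' y h h'
    by_contra hne
    have h1 := hsep m m' hne
    have h2 : ‖θ m - θ m'‖ ≤ ‖θ m - y‖ + ‖θ m' - y‖ := by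
      rw [norm_sub_rev (θ m') y]
      simpa using norm_add_le (θ m - y) (y - θ m')
    linarith
  -- Separation by `2δ` makes the nearby point unique, so the choice is determined; away from all
  -- points the default message `0` is returned.
  refine ⟨fun y => if h : ∃ m, ‖θ m - y‖ < δ then h.choose else ⟨0, hK⟩, ?_, ?_⟩
  · refine measurable_to_countable' fun m => ?_
    have hopen : ∀ m, MeasurableSet {y | ‖θ m - y‖ < δ} := fun m =>
      measurableSet_lt (by fun_prop) measurable_const
    have hall : MeasurableSet {y | ∃ m, ‖θ m - y‖ < δ} := by
      simp only [Set.ofPred_exists]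
      exact MeasurableSet.iUnion hopen
    have heq : (fun y => if h : ∃ m, ‖θ m - y‖ < δ then h.choose else ⟨0, hK⟩) ⁻¹' {m} =
        {y | ‖θ m - y‖ < δ} ∪ ({y | ∃ m, ‖θ m - y‖ < δ}ᶜ ∩ {_y | (⟨0, hK⟩ : Fin K) = m}) := by
      ext y
      simp only [Set.mem_preimage, Set.mem_singleton_iff, Set.mem_union, Set.mem_inter_iff,
        Set.mem_compl_iff, Set.mem_ofPred_eq]
      by_cases h : ∃ m, ‖θ m - y‖ < δ
      · rw [dif_pos h]
        constructor
        · rintro rfl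
          exact Or.inl h.choose_spec
        · rintro (h' | h')
          · exact huniq h.choose_spec h'
          · exact absurd h h'.1
      · rw [dif_neg h]
        constructor
        · exact fun h' => Or.inr ⟨h, h'⟩
        · rintro (h' | h')
          · exact absurd ⟨m, h'⟩ h
          · exact h'.2
    rw [heq]
    exact (hopen m).union (hall.compl.inter (MeasurableSet.const _))
  · intro m y h
    have hex : ∃ m, ‖θ m - y‖ < δ := ⟨m, h⟩
    change (if h : ∃ m, ‖θ m - y‖ < δ then h.choose else ⟨0, hK⟩) = m
    rw [dif_pos hex]
    exact huniq hex.choose_spec h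

/-- A `k × k` grid in the unit square. -/
noncomputable def gridPoint (k m : ℕ) : ℂ :=
  ⟨(((m / k : ℕ) : ℝ) + 1 / 2) / k, (((m % k : ℕ) : ℝ) + 1 / 2) / k⟩

lemma gridPoint_mem_unitSquare {k m : ℕ} (hm : m < k ^ 2) : gridPoint k m ∈ unitSquare := by
  have hk : 0 < k := Nat.pos_of_ne_zero (by rintro rfl; simp at hm)
  have hk' : (0 : ℝ) < k := by exact_mod_cast hk
  have key : ∀ a : ℕ, a < k → ((a : ℝ) + 1 / 2) / k ∈ Set.Ioo (0 : ℝ) 1 := by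
    intro a ha
    have : (a : ℝ) + 1 ≤ k := by exact_mod_cast ha
    exact ⟨by positivity, by rw [div_lt_one hk']; linarith⟩
  exact ⟨key _ (Nat.div_lt_of_lt_mul (by rwa [← sq])), key _ (Nat.mod_lt _ hk)⟩

/-- Distinct indices differ in quotient or remainder modulo `k`, so one coordinate differs by at
least `1/k`. -/
lemma gridPoint_separated {k m m' : ℕ} (hk : 0 < k) (h : m ≠ m') :
    2 * (1 / (2 * (k : ℝ))) ≤ ‖gridPoint k m - gridPoint k m'‖ := by
  have hk' : (0 : ℝ) < k := by exact_mod_cast hk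
  have key : ∀ a b : ℕ, a ≠ b →
      2 * (1 / (2 * (k : ℝ))) ≤ |((a : ℝ) + 1 / 2) / k - ((b : ℝ) + 1 / 2) / k| := by
    intro a b hab
    have h1 : (1 : ℝ) ≤ |(a : ℝ) - b| := by
      have : (1 : ℤ) ≤ |(a : ℤ) - b| := Int.one_le_abs (by omega)
      exact_mod_cast this
    rw [← sub_div, add_sub_add_right_eq_sub, abs_div, abs_of_pos hk', le_div_iff₀ hk']
    calc 2 * (1 / (2 * (k : ℝ))) * k = 1 := by field_simp
      _ ≤ _ := h1
  by_cases hd : m / k = m' / k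
  · have hmod : m % k ≠ m' % k := fun hmod => h (by
      rw [← Nat.div_add_mod m k, ← Nat.div_add_mod m' k, hd, hmod])
    exact (key _ _ hmod).trans (Complex.abs_im_le_norm (gridPoint k m - gridPoint k m'))
  · exact (key _ _ hd).trans (Complex.abs_re_le_norm (gridPoint k m - gridPoint k m'))

/-- The side length of the message grid of rate `r`. -/
noncomputable def gridSize (n : ℕ) (r : ℝ) : ℕ := ⌈((2 : ℝ) ^ r) ^ n⌉₊

lemma gridSize_pos (n : ℕ) (r : ℝ) : 0 < gridSize n r := Nat.ceil_pos.2 (by positivity)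

lemma messageCount_pos (n : ℕ) (r : ℝ) : 0 < messageCount n r := Nat.ceil_pos.2 (by positivity)

lemma messageCount_le_gridSize_sq (n : ℕ) (r : ℝ) : messageCount n r ≤ gridSize n r ^ 2 := by
  refine Nat.ceil_le.2 ?_
  have h : (2 : ℝ) ^ (2 * n * r) = (((2 : ℝ) ^ r) ^ n) ^ 2 := by
    rw [← Real.rpow_mul_natCast (by norm_num), ← Real.rpow_mul_natCast (by norm_num)]
    congr 1
    push_cast
    ring
  rw [h]
  push_cast
  exact pow_le_pow_left₀ (by positivity) (Nat.le_ceil _) 2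

lemma gridSize_le {r : ℝ} (hr : 0 ≤ r) (n : ℕ) : (gridSize n r : ℝ) ≤ 2 * ((2 : ℝ) ^ r) ^ n := by
  have h1 : 1 ≤ ((2 : ℝ) ^ r) ^ n := one_le_pow₀ (Real.one_le_rpow (by norm_num) hr)
  have h2 := Nat.ceil_lt_add_one (a := ((2 : ℝ) ^ r) ^ n) (by positivity)
  rw [gridSize]
  linarith

variable {N : ℕ} {β : ℝ}

lemma isProbabilityMeasure_discreteMessageLaw {K : Fin N → ℕ} (hK : ∀ j, 0 < K j) :
    IsProbabilityMeasure (discreteMessageLaw K) := by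
  have : ∀ j, IsProbabilityMeasure (uniformOn (Set.univ : Set (Fin (K j)))) := fun j =>
    isProbabilityMeasure_uniformOn Set.finite_univ ⟨⟨0, hK j⟩, trivial⟩
  unfold discreteMessageLaw
  infer_instance

lemma measurable_messagePoint {K : Fin N → ℕ} (θ : ∀ j, Fin (K j) → ℂ) :
    Measurable (messagePoint θ) :=
  measurable_pi_lambda _ fun j => (measurable_of_finite (θ j)).comp (measurable_pi_apply j)

lemma isProbabilityMeasure_map_messagePoint {K : Fin N → ℕ} (hK : ∀ j, 0 < K j)
    (θ : ∀ j, Fin (K j) → ℂ) :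
    IsProbabilityMeasure ((discreteMessageLaw K).map (messagePoint θ)) := by
  have := isProbabilityMeasure_discreteMessageLaw hK
  exact Measure.isProbabilityMeasure_map (measurable_messagePoint θ).aemeasurable

lemma ae_map_messagePoint_norm_le {K : Fin N → ℕ} {θ : ∀ j, Fin (K j) → ℂ}
    (hθ : ∀ j m, θ j m ∈ unitSquare) :
    ∀ᵐ s ∂(discreteMessageLaw K).map (messagePoint θ), ∀ k, ‖s k‖ ≤ 2 := by
  refine (ae_map_iff (measurable_messagePoint θ).aemeasurable ?_).2
    (Eventually.of_forall fun m k => norm_le_two_of_mem_unitSquare (hθ k (m k)))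
  simp only [Set.ofPred_forall]
  exact MeasurableSet.iInter fun k => measurableSet_le (by fun_prop) measurable_const

/-- A wrong decision for sender `j` forces `β^(-n) |S_n(j)| ≥ δ_j`; Markov's inequality for the
square and a union bound conclude. -/
lemma errorProbability_le (hβ : 1 < β) {K : Fin N → ℕ} (hK : ∀ j, 0 < K j)
    (θ : ∀ j, Fin (K j) → ℂ) (dec : ∀ j, ℂ → Fin (K j)) {π : Controller N}
    (hπ : ∀ j i, Measurable (π j i)) (n : ℕ) {δ : Fin N → ℝ} (hδ : ∀ j, 0 < δ j)
    (hdec : ∀ j m y, ‖θ j m - y‖ < δ j → dec j y = m) :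
    errorProbability (symmetricA N β) π n θ dec ≤
      ∑ j, ENNReal.ofReal (((β ^ n)⁻¹ / δ j) ^ 2) *
        stateMoment (symmetricA N β) π ((discreteMessageLaw K).map (messagePoint θ)) n j := by
  have := isProbabilityMeasure_discreteMessageLaw hK
  have hθm := measurable_messagePoint θ
  have hmp : MeasurePreserving (Prod.map (messagePoint θ) (id : (ℕ → ℂ) → (ℕ → ℂ)))
      ((discreteMessageLaw K).prod noiseLaw)
      (((discreteMessageLaw K).map (messagePoint θ)).prod noiseLaw) :=
    (hθm.measurePreserving _).prod (MeasurePreserving.id _)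
  have hsub : {p : (∀ j, Fin (K j)) × (ℕ → ℂ) | (fun j => dec j (estimate (symmetricA N β) n
      (output (symmetricA N β) π (messagePoint θ p.1) p.2) j)) ≠ p.1} ⊆
      ⋃ j, {p | 1 ≤ ENNReal.ofReal (((β ^ n)⁻¹ / δ j) ^ 2) *
        ‖state (symmetricA N β) π (messagePoint θ p.1) p.2 n j‖ₑ ^ 2} := by
    intro p hp
    obtain ⟨j, hj⟩ := Function.ne_iff.1 hp
    refine Set.mem_iUnion.2 ⟨j, ?_⟩
    have h1 := not_lt.1 fun h => hj (hdec j (p.1 j) _ h)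
    have h2 := norm_sub_estimate hβ π (messagePoint θ p.1) p.2 n j
    change ‖θ j (p.1 j) - _‖ = _ at h2
    rw [h2] at h1
    rw [Set.mem_ofPred_eq, enorm_sq_eq_ofReal, ← ENNReal.ofReal_mul (sq_nonneg _), ← mul_pow,
      ENNReal.one_le_ofReal]
    refine one_le_pow₀ ?_
    rw [div_mul_eq_mul_div, one_le_div (hδ j)]
    exact h1
  refine (measure_mono hsub).trans ((measure_iUnion_fintype_le _ _).trans ?_)
  refine Finset.sum_le_sum fun j _ => ?_
  have hg : Measurable fun p : (Fin N → ℂ) × (ℕ → ℂ) =>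
      ENNReal.ofReal (((β ^ n)⁻¹ / δ j) ^ 2) * ‖state (symmetricA N β) π p.1 p.2 n j‖ₑ ^ 2 :=
    ((measurable_state hπ n j).enorm.pow_const 2).const_mul _
  have h3 := mul_meas_ge_le_lintegral₀ (μ := (discreteMessageLaw K).prod noiseLaw)
    (hg.comp hmp.measurable).aemeasurable 1
  rw [one_mul] at h3
  refine h3.trans (le_of_eq ?_)
  simp only [Function.comp_apply]
  rw [hmp.lintegral_comp hg, lintegral_const_mul' _ _ ENNReal.ofReal_ne_top, stateMoment]

lemma sum_userPower_le (hN : 1 ≤ N) (hβ : 1 < β) {ρ : Measure (Fin N → ℂ)}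
    [IsProbabilityMeasure ρ] (hρ : ∀ᵐ s ∂ρ, ∀ k, ‖s k‖ ≤ 2) (j : Fin N) (n : ℕ) :
    ∑ i ∈ Finset.Icc 1 n, userPower (symmetricA N β) (optController N β) ρ j i ≤
      ENNReal.ofReal (∑ i ∈ Finset.range n, gainModulus N β ^ 2 * transient N β i ^ 2 +
        n * senderPower N (β ^ 2)) := by
  have hstat := (stationaryMoment_pos (N := N) hβ).le
  have h : ∀ i, userPower (symmetricA N β) (optController N β) ρ j (i + 1) ≤
      ENNReal.ofReal (gainModulus N β ^ 2 * transient N β i ^ 2 + senderPower N (β ^ 2)) := by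
    intro i
    rw [userPower_eq hβ, ← gainModulus_sq_mul_stationaryMoment hN hβ, ← mul_add,
      ENNReal.ofReal_mul (sq_nonneg _)]
    gcongr
    exact stateMoment_le_const hN hβ hρ i j
  have hs : 0 ≤ senderPower N (β ^ 2) := (senderPower_pos hN (one_lt_sq hβ)).le
  have hsum : ∑ i ∈ Finset.range n, gainModulus N β ^ 2 * transient N β i ^ 2 +
      n * senderPower N (β ^ 2) =
      ∑ i ∈ Finset.range n, (gainModulus N β ^ 2 * transient N β i ^ 2 + senderPower N (β ^ 2)) := by
    rw [Finset.sum_add_distrib]; simp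
  rw [hsum, ENNReal.ofReal_sum_of_nonneg fun i _ => by positivity, ← Finset.Ico_add_one_right_eq_Icc,
    Finset.sum_Ico_eq_sum_range, Nat.add_sub_cancel]
  exact Finset.sum_le_sum fun i _ => by rw [add_comm 1 i]; exact h i

lemma achievesRates_optController (hN : 1 ≤ N) (hβ : 1 < β) {r : Fin N → ℝ}
    (hr0 : ∀ j, 0 ≤ r j) (hr : ∀ j, r j < Real.logb 2 β) {P : ℝ}
    (hP : senderPower N (β ^ 2) < P) :
    AchievesRates (symmetricA N β) (optController N β) r P := by
  have hlt : ∀ n j (m : Fin (messageCount n (r j))), (m : ℕ) < gridSize n (r j) ^ 2 :=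
    fun n j m => m.2.trans_le (messageCount_le_gridSize_sq n (r j))
  have hmem : ∀ n j (m : Fin (messageCount n (r j))),
      gridPoint (gridSize n (r j)) m ∈ unitSquare :=
    fun n j m => gridPoint_mem_unitSquare (hlt n j m)
  choose dec hdec1 hdec2 using fun n j => exists_measurable_decoder (messageCount_pos n (r j))
    (fun m => gridPoint (gridSize n (r j)) m) (δ := 1 / (2 * (gridSize n (r j) : ℝ)))
    (fun m m' h => gridPoint_separated (gridSize_pos n (r j)) (fun h' => h (Fin.ext h')))
  have hprob := fun n => isProbabilityMeasure_map_messagePoint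
    (K := fun j => messageCount n (r j)) (fun j => messageCount_pos n (r j))
    (fun j m => gridPoint (gridSize n (r j)) m)
  have hae := fun n => ae_map_messagePoint_norm_le (K := fun j => messageCount n (r j)) (hmem n)
  refine ⟨fun n j m => gridPoint (gridSize n (r j)) m, dec, hmem, hdec1, ?_, fun j => ?_⟩
  -- The constant is `16 = (2 · 2)²`, from the decision radius `1/(2k)` and `k ≤ 2 · 2^(rn)`. The
  -- bound decays because `2^r < β`.
  · have hlim : Tendsto (fun n : ℕ => ∑ j, ENNReal.ofReal (16 * (((2 : ℝ) ^ r j / β) ^ 2) ^ (n + 1) *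
        (transient N β n ^ 2 + stationaryMoment N β))) atTop (𝓝 0) := by
      suffices h : Tendsto (fun n : ℕ => ∑ j,
          ENNReal.ofReal (16 * (((2 : ℝ) ^ r j / β) ^ 2) ^ (n + 1) *
            (transient N β n ^ 2 + stationaryMoment N β))) atTop
              (𝓝 (∑ _j : Fin N, ENNReal.ofReal 0)) by
        simpa using h
      refine tendsto_finsetSum _ fun j _ => ENNReal.tendsto_ofReal ?_
      have h1 : ((2 : ℝ) ^ r j / β) ^ 2 < 1 := by
        refine pow_lt_one₀ (by positivity) ?_ two_ne_zero
        rw [div_lt_one (by linarith)]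
        exact (Real.lt_logb_iff_rpow_lt (by norm_num) (by linarith)).1 (hr j)
      have h2 := ((tendsto_pow_atTop_nhds_zero_of_lt_one (sq_nonneg _) h1).comp
        (tendsto_add_atTop_nat 1)).const_mul 16
      have h3 := h2.mul (((tendsto_transient hN hβ).pow 2).add_const (stationaryMoment N β))
      simpa using h3
    refine (tendsto_add_atTop_iff_nat 1).1 ?_
    refine tendsto_of_tendsto_of_tendsto_of_le_of_le tendsto_const_nhds hlim
      (fun n => zero_le) fun n => ?_
    have := hprob (n + 1)
    refine (errorProbability_le hβ (fun j => messageCount_pos (n + 1) (r j)) _ _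
      measurable_optController (n + 1) (δ := fun j => 1 / (2 * (gridSize (n + 1) (r j) : ℝ)))
      (fun j => ?_) (fun j m y h => hdec2 (n + 1) j m y h)).trans ?_
    · have := gridSize_pos (n + 1) (r j)
      positivity
    · refine Finset.sum_le_sum fun j _ => ?_
      have hstat := (stationaryMoment_pos (N := N) hβ).le
      rw [ENNReal.ofReal_mul (by positivity)]
      refine mul_le_mul' (ENNReal.ofReal_le_ofReal ?_)
        (stateMoment_le_const hN hβ (hae (n + 1)) n j)
      have hk := gridSize_le (hr0 j) (n + 1)
      have hβ0 : (0 : ℝ) < β := by linarith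
      calc ((β ^ (n + 1))⁻¹ / (1 / (2 * (gridSize (n + 1) (r j) : ℝ)))) ^ 2
          = (2 * (gridSize (n + 1) (r j) : ℝ) / β ^ (n + 1)) ^ 2 := by
            rw [div_div_eq_mul_div, div_one, inv_mul_eq_div]
        _ ≤ (2 * (2 * ((2 : ℝ) ^ r j) ^ (n + 1)) / β ^ (n + 1)) ^ 2 := by gcongr
        _ = 16 * (((2 : ℝ) ^ r j / β) ^ 2) ^ (n + 1) := by
            rw [← pow_mul, mul_comm 2 (n + 1), pow_mul, div_pow _ β]
            ring
  -- The transient has vanishing Cesàro mean, so the strict gap between `senderPower` and `P`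
  -- absorbs it in long blocks.
  · have hces : Tendsto (fun n : ℕ => (n⁻¹ : ℝ) *
        ∑ i ∈ Finset.range n, gainModulus N β ^ 2 * transient N β i ^ 2) atTop (𝓝 0) := by
      refine Tendsto.cesaro ?_
      simpa using ((tendsto_transient hN hβ).pow 2).const_mul (gainModulus N β ^ 2)
    filter_upwards [hces.eventually (gt_mem_nhds (sub_pos.2 hP)), eventually_ge_atTop 1]
      with n hn hn1
    have := hprob n
    refine (sum_userPower_le hN hβ (hae n) j n).trans (ENNReal.ofReal_le_ofReal ?_)
    have hn' : (0 : ℝ) < n := by exact_mod_cast hn1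
    rw [inv_mul_lt_iff₀ hn'] at hn
    linarith

lemma achievesSumRate_optController (hN : 1 ≤ N) (hβ : 1 < β) {R : ℝ} (hR : 0 ≤ R)
    (hRβ : R < N * Real.logb 2 β) {P : ℝ} (hP : senderPower N (β ^ 2) < P) :
    AchievesSumRate (symmetricA N β) (optController N β) R P := by
  have hN' : (0 : ℝ) < N := by exact_mod_cast hN
  refine ⟨fun _ => R / N, fun _ => by positivity, ?_,
    achievesRates_optController hN hβ (fun _ => by positivity) (fun _ => ?_) hP⟩
  · rw [Finset.sum_const, Finset.card_univ, Fintype.card_fin, nsmul_eq_mul]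
    field_simp
  · rw [div_lt_iff₀ hN']
    linarith

end Coding

/-! ### Transfer to an arbitrary positive definite solution and the critical `β`. -/

section Main

variable {N : ℕ} {β : ℝ}

lemma existsUnique_isPosDefDARESolution (hβ : 1 < β) :
    ∃! G : Matrix (Fin N) (Fin N) ℂ, IsPosDefDARESolution (symmetricA N β) G :=
  ⟨_, riccatiSolution_isPosDefDARESolution hβ, fun _ h =>
    isPosDefDARESolution_unique hβ h (riccatiSolution_isPosDefDARESolution hβ)⟩

lemma dareController_eq (hβ : 1 < β) {G : Matrix (Fin N) (Fin N) ℂ}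
    (h : IsPosDefDARESolution (symmetricA N β) G) :
    dareController (symmetricA N β) G = optController N β := by
  rw [isPosDefDARESolution_unique hβ h (riccatiSolution_isPosDefDARESolution hβ), optController]

lemma tendsto_userPower (hN : 1 ≤ N) (hβ : 1 < β) (j : Fin N) :
    Tendsto (userPower (symmetricA N β) (optController N β) (uniformMessageLaw N) j) atTop
      (𝓝 (ENNReal.ofReal (senderPower N (β ^ 2)))) := by
  have h := ENNReal.Tendsto.const_mul (a := ENNReal.ofReal (gainModulus N β ^ 2))
    (tendsto_stateMoment hN hβ (uniformMessageLaw N) (ae_uniformMessageLaw_norm_le N) j)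
    (Or.inr ENNReal.ofReal_ne_top)
  rw [← ENNReal.ofReal_mul (sq_nonneg _), gainModulus_sq_mul_stationaryMoment hN hβ] at h
  exact h.congr fun i => (userPower_eq hβ _ j i).symm

/-- The critical `β`, at which the sum rate of Kramer's code and the power `P` are attained. -/
lemma exists_critical {P φ : ℝ} (hN : 1 ≤ N) (hP : 0 < P) (hφ : IsKramerPhi N P φ) :
    ∃ β, 1 < β ∧ senderPower N (β ^ 2) = P ∧ N * Real.logb 2 β = kramerSumRate N P φ := by
  obtain ⟨b, hb, hbP, hbN⟩ := exists_of_isKramerPhi hN hP hφ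
  have hsq : Real.sqrt b ^ 2 = b := Real.sq_sqrt (by linarith)
  refine ⟨Real.sqrt b, Real.lt_sqrt_of_sq_lt (by simpa using hb), by rw [hsq, hbP], ?_⟩
  rw [kramerSumRate, ← hbN, ← hsq, ← pow_mul, Real.logb_pow, Real.sqrt_sq (Real.sqrt_nonneg b)]
  push_cast
  ring

end Main

end AWGNMAC

theorem theorem3 (N : ℕ) (hN : 1 ≤ N) (P : ℝ) (hP : 0 < P) :
    (∃! φ : ℝ, IsKramerPhi N P φ) ∧
    ∀ φ : ℝ, IsKramerPhi N P φ →
      -- every sum rate of Kramer's code, with asymptotic powers strictly below `P`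
      (∀ R : ℝ, 0 ≤ R → R < kramerSumRate N P φ →
        ∃ β : ℝ, 1 < β ∧
          (∃! G : Matrix (Fin N) (Fin N) ℂ, IsPosDefDARESolution (symmetricA N β) G) ∧
          ∀ G : Matrix (Fin N) (Fin N) ℂ, IsPosDefDARESolution (symmetricA N β) G →
            IsOptimalController (symmetricA N β) (dareController (symmetricA N β) G) ∧
            (∀ j, Tendsto (mseExponent (symmetricA N β)
              (dareController (symmetricA N β) G) j) atTop (𝓝 (Real.logb 2 β))) ∧
            R < N * Real.logb 2 β ∧
            (∃ Pbar : Fin N → ℝ, ∀ j, 0 < Pbar j ∧ Pbar j < P ∧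
              Tendsto (userPower (symmetricA N β) (dareController (symmetricA N β) G)
                (uniformMessageLaw N) j) atTop (𝓝 (ENNReal.ofReal (Pbar j)))) ∧
            AchievesSumRate (symmetricA N β) (dareController (symmetricA N β) G) R P) ∧
      -- the limiting sum rate, with asymptotic powers exactly `P`
      (∃ β : ℝ, 1 < β ∧
        (∃! G : Matrix (Fin N) (Fin N) ℂ, IsPosDefDARESolution (symmetricA N β) G) ∧
        ∀ G : Matrix (Fin N) (Fin N) ℂ, IsPosDefDARESolution (symmetricA N β) G →
          IsOptimalController (symmetricA N β) (dareController (symmetricA N β) G) ∧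
          (∀ j, Tendsto (mseExponent (symmetricA N β)
            (dareController (symmetricA N β) G) j) atTop (𝓝 (Real.logb 2 β))) ∧
          N * Real.logb 2 β = kramerSumRate N P φ ∧
          (∀ j, Tendsto (userPower (symmetricA N β) (dareController (symmetricA N β) G)
            (uniformMessageLaw N) j) atTop (𝓝 (ENNReal.ofReal P))) ∧
          ∀ R : ℝ, 0 ≤ R → R < kramerSumRate N P φ → ∀ P' : ℝ, P < P' →
            AchievesSumRate (symmetricA N β) (dareController (symmetricA N β) G) R P') := by
  refine ⟨existsUnique_isKramerPhi hN hP, fun φ hφ => ?_⟩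
  have hN' : (0 : ℝ) < N := by exact_mod_cast hN
  obtain ⟨β₀, hβ₀, hβP, hβR⟩ := exists_critical hN hP hφ
  refine ⟨fun R hR0 hR => ?_, β₀, hβ₀, existsUnique_isPosDefDARESolution hβ₀, fun G hG => ?_⟩
  · have hlog₀ : 0 < Real.logb 2 β₀ := Real.logb_pos (by norm_num) hβ₀
    have hRlog : R / N < Real.logb 2 β₀ := by
      rw [div_lt_iff₀ hN']
      linarith
    -- `β = 2^l` lies strictly below the critical `β₀`, which leaves power to spare by monotonicity,
    -- while `N l` still exceeds `R`.
    obtain ⟨l, hl1, hl2⟩ := exists_between hRlog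
    have hl0 : 0 < l := lt_of_le_of_lt (by positivity) hl1
    have hβ : 1 < (2 : ℝ) ^ l := Real.one_lt_rpow (by norm_num) hl0
    have hlog : Real.logb 2 ((2 : ℝ) ^ l) = l := Real.logb_rpow (by norm_num) (by norm_num)
    have hlt : (2 : ℝ) ^ l < β₀ := (Real.lt_logb_iff_rpow_lt (by norm_num) (by linarith)).1 hl2
    have hpow : senderPower N (((2 : ℝ) ^ l) ^ 2) < P := by
      rw [← hβP]
      refine senderPower_strictMonoOn hN (one_lt_sq hβ).le (one_lt_sq hβ₀).le ?_
      gcongr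
    have hrate : R < N * Real.logb 2 ((2 : ℝ) ^ l) := by
      rw [hlog, mul_comm]
      exact (div_lt_iff₀ hN').1 hl1
    refine ⟨(2 : ℝ) ^ l, hβ, existsUnique_isPosDefDARESolution hβ, fun G hG => ?_⟩
    rw [dareController_eq hβ hG]
    exact ⟨isOptimalController_optController hN hβ, tendsto_mseExponent hN hβ, hrate,
      ⟨fun _ => senderPower N (((2 : ℝ) ^ l) ^ 2), fun j =>
        ⟨senderPower_pos hN (one_lt_sq hβ), hpow, tendsto_userPower hN hβ j⟩⟩,
      achievesSumRate_optController hN hβ hR0 hrate hpow⟩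
  · rw [dareController_eq hβ₀ hG]
    exact ⟨isOptimalController_optController hN hβ₀, tendsto_mseExponent hN hβ₀, hβR,
      fun j => hβP ▸ tendsto_userPower hN hβ₀ j, fun R hR0 hR P' hP' =>
        achievesSumRate_optController hN hβ₀ hR0 (hβR ▸ hR) (hβP ▸ hP')⟩
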